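/- Let $0<q<1/2$, $p=1-q$, $\lambda=q/p$, let $\tau_0,b>0$ and $v\in\mathbb R$, and let $z\ge 1$ and $A\ge z$ be integers. Honest miners and an attacker discover blocks; the times between successive blocks of the honest miners (resp. of the attacker) are exponential random variables of rate $p/\tau_0$ (resp. $q/\tau_0$), and all of them are independent. So the numbers $N(t)$, $N'(t)$ of blocks discovered up to time $t$ are independent Poisson processes. A cycle of the $(A,1)$-Nakamoto double spend strategy starts at time $0$. The attacker first mines on top of the official blockchain (restarting on its new last block whenever the honest miners find one) until the time $S'_1$ of his first block; he keeps this block secret, sends the purchasing transaction and goes on mining on his secret fork. For $t\ge S'_1$ the official blockchain has since gained $H(t)=N(t)-N(S'_1)$ blocks and the secret fork has $F(t)=1+N'(t)-N'(S'_1)$ blocks. The cycle ends at the first time $\mathbf T_A\ge S'_1$ at which either $H-F\ge A$ (the attacker gives up), or $H\ge z$ and $F>H$ (success). The revenue $\mathbf R_A$ is $v+b\,F(\mathbf T_A)$ after a success and $0$ otherwise, $P_A(z)$ is the probability of success, and $\Gamma_A=\mathbb E[\mathbf R_A]/\mathbb E[\mathbf T_A]$ is the revenue ratio. Write $[n]=\frac{1-\lambda^n}{1-\lambda}$,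 $B(a,b)=\frac{\Gamma(a)\Gamma(b)}{\Gamma(a+b)}$ and $I_x(a,b)=\frac{\Gamma(a+b)}{\Gamma(a)\Gamma(b)}\int_0^x t^{a-1}(1-t)^{b-1}\,dt$. Then the cycle ends almost surely, $\mathbf R_A$ and $\mathbf T_A$ are integrable, $\mathbb E[\mathbf T_A]>0$, $$P_A(z)=\frac{I_{4pq}(z,1/2)-\lambda^{A+1}}{1-\lambda^{A+1}},$$ $$\frac{\mathbb E[\mathbf R_A]}{b}=\frac{qz}{2p}I_{4pq}(z,1/2)-\frac{(A+1)\lambda^{A+1}}{p(1-\lambda)^3[A+1]^2}I_{(p-q)^2}(1/2,z)+\frac{2-\lambda+\lambda^{A+2}}{(1-\lambda)^2[A+1]}\,\frac{p^{z-1}q^z}{B(z,z)}+P_A(z)\left(\frac vb+1\right),$$ $$\frac{\mathbb E[\mathbf T_A]}{\tau_0}=\frac{z}{2p}I_{4pq}(z,1/2)+\frac{A+1}{p(1-\lambda)^2[A+1]}I_{(p-q)^2}(1/2,z)-\frac{p^{z-1}q^z}{p(1-\lambda)B(z,z)}+\frac1q,$$ and $\Gamma_A$ equals $b/\tau_0$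 times the quotient of the last two right-hand sides. -/

import Mathlib

open MeasureTheory ProbabilityTheory

/-- The regularized incomplete Beta function
`I_x(a,b) = Γ(a+b) / (Γ(a) Γ(b)) ∫₀ˣ t^(a-1) (1-t)^(b-1) dt`. -/
noncomputable def regIncBeta (x a b : ℝ) : ℝ :=
  Real.Gamma (a + b) / (Real.Gamma a * Real.Gamma b) *
    ∫ t in (0 : ℝ)..x, t ^ (a - 1) * (1 - t) ^ (b - 1)

/-- The notation `[n] = (1 - λ^n) / (1 - λ)`. -/
noncomputable def lamBracket (lam : ℝ) (n : ℕ) : ℝ := (1 - lam ^ n) / (1 - lam)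

namespace Nakamoto

variable {Ω : Type*}

/-- The mining model. `X i` is the time that the honest miners need for their `(i+1)`-th block
after their `i`-th one, and `Y i` is the same for the attacker.  All these times are independent;
those of the honest miners are exponential of rate `p / τ₀`, those of the attacker exponential of
rate `q / τ₀`.  Equivalently, the numbers of blocks mined up to time `t` by the two sides are two
independent Poisson processes of rates `p / τ₀` and `q / τ₀`. -/
structure IsMiningRace [MeasurableSpace Ω] (μ : Measure Ω) (p q τ₀ : ℝ)
    (X Y : ℕ → Ω → ℝ) : Prop where
  honest_law : ∀ i, HasLaw (X i) (expMeasure (p / τ₀)) μ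
  attacker_law : ∀ i, HasLaw (Y i) (expMeasure (q / τ₀)) μ
  indep : iIndepFun (Sum.elim X Y) μ

/-- The time at which the `n`-th block is discovered (`0` for `n = 0`), given the times between
successive blocks. For the honest miners this is `S_n`, for the attacker `S'_n`. -/
noncomputable def discoveryTime (X : ℕ → Ω → ℝ) (n : ℕ) (ω : Ω) : ℝ :=
  ∑ i ∈ Finset.range n, X i ω

/-- The number of blocks discovered up to time `t`: the number of `n ≥ 1` such that the `n`-th
block is discovered at the latest at time `t`. For the honest miners this is `N(t)`, for the
attacker `N'(t)`. -/
noncomputable def blockCount (X : ℕ → Ω → ℝ) (t : ℝ) (ω : Ω) : ℕ :=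
  {n : ℕ | discoveryTime X (n + 1) ω ≤ t}.ncard

/-- The end of the pre-mining phase. The attacker mines on the last block of the official
blockchain, restarting on the new last block whenever the honest miners find one first; with one
block to pre-mine, the phase ends when the attacker discovers his first block. -/
noncomputable def launchTime (Y : ℕ → Ω → ℝ) (ω : Ω) : ℝ := discoveryTime Y 1 ω

/-- The number of blocks added to the official blockchain between the launch of the attack and
time `t`; these are the confirmations of the vendor's transaction. -/
noncomputable def confirmations (X Y : ℕ → Ω → ℝ) (t : ℝ) (ω : Ω) : ℤ :=
  (blockCount X t ω : ℤ) - blockCount X (launchTime Y ω) ω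

/-- The length of the secret fork at time `t`: the pre-mined block and the blocks discovered by
the attacker since the launch of the attack. -/
noncomputable def secretFork (Y : ℕ → Ω → ℝ) (t : ℝ) (ω : Ω) : ℤ :=
  1 + ((blockCount Y t ω : ℤ) - blockCount Y (launchTime Y ω) ω)

/-- The lag of the secret fork behind the official blockchain, both being counted from the block
on which the fork was started. -/
noncomputable def lag (X Y : ℕ → Ω → ℝ) (t : ℝ) (ω : Ω) : ℤ :=
  confirmations X Y t ω - secretFork Y t ω

/-- At time `t` the attacker lags by `A` (or more) blocks, and gives up. -/
def GivesUpAt (A : ℕ) (X Y : ℕ → Ω → ℝ) (t : ℝ) (ω : Ω) : Prop :=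
  (A : ℤ) ≤ lag X Y t ω

/-- At time `t` the vendor's transaction has its `z` confirmations and the secret fork is longer
than the official blockchain, so that the attacker can release it with success. -/
def SucceedsAt (z : ℕ) (X Y : ℕ → Ω → ℝ) (t : ℝ) (ω : Ω) : Prop :=
  (z : ℤ) ≤ confirmations X Y t ω ∧ lag X Y t ω < 0

/-- The times after the launch at which a condition that ends the attack cycle of the
`(A,1)`-Nakamoto double spend strategy is fulfilled. -/
def endingTimes (A z : ℕ) (X Y : ℕ → Ω → ℝ) (ω : Ω) : Set ℝ :=
  {t | launchTime Y ω ≤ t ∧ (GivesUpAt A X Y t ω ∨ SucceedsAt z X Y t ω)}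

/-- The duration `T_A` of an attack cycle (it starts at time `0`, with the pre-mining). -/
noncomputable def cycleDuration (A z : ℕ) (X Y : ℕ → Ω → ℝ) (ω : Ω) : ℝ :=
  sInf (endingTimes A z X Y ω)

/-- The attack cycle ends with a successful double spend. -/
def IsSuccess (A z : ℕ) (X Y : ℕ → Ω → ℝ) (ω : Ω) : Prop :=
  SucceedsAt z X Y (cycleDuration A z X Y ω) ω

open Classical in
/-- The revenue `R_A` of an attack cycle: after a success the double spend amount `v` and the
reward `b` of every block of the attacker's fork (the pre-mined one included), otherwise `0`. -/
noncomputable def revenue (A z : ℕ) (v b : ℝ) (X Y : ℕ → Ω → ℝ) (ω : Ω) : ℝ :=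
  if IsSuccess A z X Y ω then v + b * (secretFork Y (cycleDuration A z X Y ω) ω : ℝ) else 0

/-- The probability of success `P_A(z)` of the attack. -/
noncomputable def successProb [MeasurableSpace Ω] (μ : Measure Ω) (A z : ℕ)
    (X Y : ℕ → Ω → ℝ) : ℝ :=
  μ.real {ω | IsSuccess A z X Y ω}

/-- The revenue ratio `Γ_A = E[R_A] / E[T_A]`. -/
noncomputable def revenueRatio [MeasurableSpace Ω] (μ : Measure Ω) (A z : ℕ) (v b : ℝ)
    (X Y : ℕ → Ω → ℝ) : ℝ :=
  (∫ ω, revenue A z v b X Y ω ∂μ) / ∫ ω, cycleDuration A z X Y ω ∂μ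

end Nakamoto

/-!
By the memorylessness of the exponential law, the miners of the successive blocks of the race are
independent coin tosses with probabilities `p` and `q`, and they are independent of the times
between the blocks, whose mean is `τ₀`. The number of confirmations and the length of the secret
fork form a Markov chain, and an expectation over the attack cycle is the value of a game on this
chain, the bounded-growth solution of the one-step equations. A Lyapunov function `α ^ h * β ^ f`
with `p * α + q * β < 1` shows that the game ends almost surely, that the payoff is integrable and
that the solution is unique.

Once the `z` confirmations are there, the game is the gambler's ruin on the lag, which has a closed
form. Before that, the number of blocks of the attacker is negative binomial; the expectation of the
ruin formulas over it only involves the distribution function `I_q(z, z)` of this law and its atom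
at `z`. The quadratic transformation `I_{4q(1-q)}(z, 1/2) = 2 * I_q(z, z)`, a substitution in the
integral, gives the formulas of the theorem.
-/

namespace Nakamoto

open scoped ENNReal NNReal

section Exponential

variable {r s : ℝ}

lemma lintegral_expMeasure {g : ℝ → ℝ≥0∞} (hg : Measurable g) :
    ∫⁻ x, g x ∂expMeasure r =
      ∫⁻ x in Set.Ioi 0, ENNReal.ofReal (r * Real.exp (-(r * x))) * g x := by
  have hpdf : Measurable (gammaPDF 1 r) := (measurable_gammaPDFReal 1 r).ennreal_ofReal
  rw [expMeasure, gammaMeasure, lintegral_withDensity_eq_lintegral_mul _ hpdf hg,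
    setLIntegral_congr Ioi_ae_eq_Ici, ← lintegral_indicator measurableSet_Ici]
  refine lintegral_congr fun x => ?_
  by_cases hx : 0 ≤ x
  · simp [gammaPDF_of_nonneg hx, hx]
  · simp [gammaPDF_of_neg (not_le.mp hx), hx]

-- `x` times the density of rate `r` is `1 / r` times the density of the Gamma law of shape `2`.
lemma lintegral_id_expMeasure (hr : 0 < r) :
    ∫⁻ x, ENNReal.ofReal x ∂expMeasure r = ENNReal.ofReal (1 / r) := by
  have hgamma : ∫⁻ x in Set.Ioi 0, gammaPDF 2 r x = 1 := by
    rw [← lintegral_gammaPDF_eq_one (a := 2) two_pos hr, setLIntegral_congr Ioi_ae_eq_Ici,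
      ← lintegral_indicator measurableSet_Ici]
    refine lintegral_congr fun x => ?_
    by_cases hx : 0 ≤ x
    · simp [hx]
    · simp [hx, gammaPDF_of_neg (not_le.mp hx)]
  rw [lintegral_expMeasure ENNReal.measurable_ofReal, ← mul_one (ENNReal.ofReal (1 / r)), ← hgamma,
    ← lintegral_const_mul _ (show Measurable (gammaPDF 2 r) from
      (measurable_gammaPDFReal 2 r).ennreal_ofReal)]
  refine setLIntegral_congr_fun measurableSet_Ioi fun x (hx : 0 < x) => ?_
  simp only [gammaPDF_of_nonneg hx.le]
  rw [← ENNReal.ofReal_mul (by positivity), ← ENNReal.ofReal_mul (by positivity)]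
  congr 1
  norm_num
  field_simp

lemma ae_expMeasure_pos (r : ℝ) : ∀ᵐ x ∂expMeasure r, 0 < x := by
  have hnull : expMeasure r (Set.Iic 0) = 0 := by
    rw [← lintegral_indicator_one measurableSet_Iic,
      lintegral_expMeasure (measurable_one.indicator measurableSet_Iic),
      setLIntegral_congr_fun (g := 0) measurableSet_Ioi
        fun x hx => by simp [Set.mem_Ioi.mp hx]]
    exact lintegral_zero
  filter_upwards [measure_eq_zero_iff_ae_notMem.mp hnull] with x hx
  exact not_le.mp hx

lemma expMeasure_singleton (r c : ℝ) : expMeasure r {c} = 0 :=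
  withDensity_absolutelyContinuous _ _ Real.volume_singleton

lemma lintegral_expMeasure_memoryless {h : ℝ → ℝ≥0∞} (hh : Measurable h) {u : ℝ} (hu : 0 ≤ u) :
    ∫⁻ w, (Set.Ioi u).indicator (fun w => h (w - u)) w ∂expMeasure r =
      ENNReal.ofReal (Real.exp (-(r * u))) * ∫⁻ w, h w ∂expMeasure r := by
  rw [lintegral_expMeasure ((show Measurable fun w => h (w - u) by fun_prop).indicator
      measurableSet_Ioi),
    lintegral_expMeasure hh, ← lintegral_const_mul _ (by fun_prop),
    ← lintegral_indicator measurableSet_Ioi, ← lintegral_indicator measurableSet_Ioi,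
    ← lintegral_add_right_eq_self _ u]
  refine lintegral_congr fun x => ?_
  by_cases hx : 0 < x
  · have hxu : 0 < x + u := by linarith
    simp only [Set.indicator_of_mem, Set.mem_Ioi, hx, hxu, lt_add_iff_pos_left,
      add_sub_cancel_right]
    rw [← mul_assoc, ← ENNReal.ofReal_mul (by positivity), mul_left_comm, ← Real.exp_add]
    ring_nf
  · simp [Set.indicator, hx]

lemma lintegral_mul_exp_neg_expMeasure (hr : 0 < r) (hs : 0 < s) {g : ℝ → ℝ≥0∞}
    (hg : Measurable g) :
    ∫⁻ u, g u * ENNReal.ofReal (Real.exp (-(s * u))) ∂expMeasure r =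
      ENNReal.ofReal (r / (r + s)) * ∫⁻ u, g u ∂expMeasure (r + s) := by
  rw [lintegral_expMeasure (by fun_prop), lintegral_expMeasure hg,
    ← lintegral_const_mul _ (by fun_prop)]
  refine lintegral_congr fun x => ?_
  rw [mul_left_comm, mul_comm, ← ENNReal.ofReal_mul (by positivity), ← mul_assoc,
    ← ENNReal.ofReal_mul (by positivity),
    show -((r + s) * x) = -(r * x) + -(s * x) by ring, Real.exp_add]
  congr 2
  field_simp

lemma lintegral_expMeasure_race (hr : 0 < r) (hs : 0 < s) {g h : ℝ → ℝ≥0∞} (hg : Measurable g)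
    (hh : Measurable h) :
    ∫⁻ u, g u * ∫⁻ w, (Set.Ioi u).indicator (fun w => h (w - u)) w ∂expMeasure s ∂expMeasure r =
      ENNReal.ofReal (r / (r + s)) * (∫⁻ u, g u ∂expMeasure (r + s)) * ∫⁻ w, h w ∂expMeasure s := by
  have hmemoryless : ∀ᵐ u ∂expMeasure r,
      g u * ∫⁻ w, (Set.Ioi u).indicator (fun w => h (w - u)) w ∂expMeasure s =
        g u * ENNReal.ofReal (Real.exp (-(s * u))) * ∫⁻ w, h w ∂expMeasure s := by
    filter_upwards [ae_expMeasure_pos r] with u hu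
    rw [lintegral_expMeasure_memoryless hh hu.le, mul_assoc]
  rw [lintegral_congr_ae hmemoryless, lintegral_mul_const _ (by fun_prop),
    lintegral_mul_exp_neg_expMeasure hr hs hg]

lemma integrable_id_expMeasure (hr : 0 < r) : Integrable (fun x => x) (expMeasure r) := by
  refine ⟨aestronglyMeasurable_id, ?_⟩
  rw [hasFiniteIntegral_iff_ofReal ((ae_expMeasure_pos r).mono fun _ hx => hx.le)]
  simpa only [lintegral_id_expMeasure hr] using ENNReal.ofReal_lt_top

lemma integral_id_expMeasure (hr : 0 < r) : ∫ x, x ∂expMeasure r = 1 / r := by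
  rw [integral_eq_lintegral_of_nonneg_ae ((ae_expMeasure_pos r).mono fun _ hx => hx.le)
    aestronglyMeasurable_id, lintegral_id_expMeasure hr]
  exact ENNReal.toReal_ofReal (by positivity)

end Exponential

section Sequences

variable {α : Type*}

/-- The sequence with first term `a`, followed by the terms of `x`. -/
def seqCons (a : α) (x : ℕ → α) : ℕ → α
  | 0 => a
  | n + 1 => x n

/-- The sequence `x` without its first term. -/
def seqTail (x : ℕ → α) : ℕ → α := fun n => x (n + 1)

@[simp] lemma seqCons_zero (a : α) (x : ℕ → α) : seqCons a x 0 = a := rfl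

@[simp] lemma seqCons_succ (a : α) (x : ℕ → α) (n : ℕ) : seqCons a x (n + 1) = x n := rfl

@[simp] lemma seqTail_seqCons (a : α) (x : ℕ → α) : seqTail (seqCons a x) = x := rfl

variable [MeasurableSpace α]

@[fun_prop]
lemma measurable_seqTail : Measurable (seqTail : (ℕ → α) → ℕ → α) :=
  measurable_pi_iff.mpr fun n => measurable_pi_apply (n + 1)

@[fun_prop]
lemma measurable_seqCons : Measurable fun a : α × (ℕ → α) => seqCons a.1 a.2 := by
  refine measurable_pi_iff.mpr fun n => ?_
  cases n with
  | zero => exact measurable_fst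
  | succ n => exact (measurable_pi_apply n).comp measurable_snd

lemma map_seqCons_infinitePi (ν : Measure α) [IsProbabilityMeasure ν] :
    (ν.prod (Measure.infinitePi fun _ : ℕ => ν)).map (fun a => seqCons a.1 a.2) =
      Measure.infinitePi fun _ => ν := by
  classical
  refine Measure.eq_infinitePi _ fun s t ht => ?_
  obtain ⟨n, hn⟩ := s.exists_nat_subset_range
  have hs : s ⊆ Finset.range (n + 1) := hn.trans (Finset.range_mono n.le_succ)
  set t' : ℕ → Set α := fun i => if i ∈ s then t i else Set.univ with ht'
  have ht'm : ∀ i, MeasurableSet (t' i) := fun i => by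
    simp only [ht']; split_ifs; exacts [ht i, .univ]
  have hpi : Set.pi (s : Set ℕ) t = Set.pi (Finset.range (n + 1) : Set ℕ) t' := by
    ext x
    simp only [Set.mem_pi, ht']
    refine ⟨fun h i _ => ?_, fun h i hi => by simpa [Finset.mem_coe.mp hi] using h i (hs hi)⟩
    split_ifs with hi
    exacts [h i hi, Set.mem_univ _]
  have hpre : (fun a : α × (ℕ → α) => seqCons a.1 a.2) ⁻¹'
      Set.pi (Finset.range (n + 1) : Set ℕ) t' =
      t' 0 ×ˢ Set.pi (Finset.range n : Set ℕ) fun i => t' (i + 1) := by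
    ext ⟨a, x⟩
    simp only [Set.mem_preimage, Set.mem_pi, Set.mem_prod, Finset.coe_range, Set.mem_Iio]
    exact ⟨fun h => ⟨h 0 n.succ_pos, fun i hi => h (i + 1) (by lia)⟩,
      fun ⟨h0, h1⟩ i => i.casesOn (fun _ => h0) fun i hi => h1 i (by lia)⟩
  rw [hpi, Measure.map_apply measurable_seqCons
      (MeasurableSet.pi (Finset.countable_toSet _) fun i _ => ht'm i),
    hpre, Measure.prod_prod, Measure.infinitePi_pi _ fun i _ => ht'm (i + 1), mul_comm,
    ← Finset.prod_range_succ' fun i => ν (t' i)]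
  refine (Finset.prod_subset_one_on_sdiff hs (fun i hi => ?_) fun i hi => ?_).symm
  · simp [ht', (Finset.mem_sdiff.mp hi).2]
  · simp [ht', hi]

lemma lintegral_infinitePi_seqCons (ν : Measure α) [IsProbabilityMeasure ν]
    {F : (ℕ → α) → ℝ≥0∞} (hF : Measurable F) :
    ∫⁻ x, F x ∂(Measure.infinitePi fun _ => ν) =
      ∫⁻ a, ∫⁻ x, F (seqCons a x) ∂(Measure.infinitePi fun _ => ν) ∂ν := by
  conv_lhs => rw [← map_seqCons_infinitePi ν]
  rw [lintegral_map hF measurable_seqCons,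
    lintegral_prod _ (by fun_prop)]

end Sequences

section Renewal

variable {a b : ℝ}

/-- A realization of the race: the times between successive blocks of the honest miners (first
component) and of the attacker (second component). -/
abbrev Race := (ℕ → ℝ) × (ℕ → ℝ)

/-- The law of a sequence of independent exponential random variables of rate `r`. -/
noncomputable def expSeq (r : ℝ) : Measure (ℕ → ℝ) := Measure.infinitePi fun _ => expMeasure r

/-- The law of the race between honest miners of rate `a` and an attacker of rate `b`. -/
noncomputable def raceLaw (a b : ℝ) : Measure Race := (expSeq a).prod (expSeq b)

lemma isProbabilityMeasure_expSeq (ha : 0 < a) : IsProbabilityMeasure (expSeq a) := by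
  have := isProbabilityMeasure_expMeasure ha
  unfold expSeq
  infer_instance

lemma isProbabilityMeasure_raceLaw (ha : 0 < a) (hb : 0 < b) :
    IsProbabilityMeasure (raceLaw a b) := by
  have := isProbabilityMeasure_expSeq ha
  have := isProbabilityMeasure_expSeq hb
  unfold raceLaw
  infer_instance

lemma map_eval_expSeq (ha : 0 < a) (n : ℕ) : (expSeq a).map (fun x => x n) = expMeasure a := by
  have := isProbabilityMeasure_expMeasure ha
  exact Measure.infinitePi_map_eval (μ := fun _ => expMeasure a) n

lemma map_swap_raceLaw (ha : 0 < a) (hb : 0 < b) : (raceLaw a b).map Prod.swap = raceLaw b a := by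
  have := isProbabilityMeasure_expSeq ha
  have := isProbabilityMeasure_expSeq hb
  exact Measure.prod_swap

lemma lintegral_raceLaw_swap (ha : 0 < a) (hb : 0 < b) {F : Race → ℝ≥0∞} (hF : Measurable F) :
    ∫⁻ w, F w.swap ∂raceLaw a b = ∫⁻ w, F w ∂raceLaw b a := by
  rw [← map_swap_raceLaw ha hb, lintegral_map hF measurable_swap]

lemma lintegral_raceLaw_seqCons_fst (ha : 0 < a) (hb : 0 < b) {F : Race → ℝ≥0∞}
    (hF : Measurable F) :
    ∫⁻ w, F w ∂raceLaw a b =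
      ∫⁻ s, ∫⁻ w, F (seqCons s w.1, w.2) ∂raceLaw a b ∂expMeasure a := by
  have := isProbabilityMeasure_expMeasure ha
  have := isProbabilityMeasure_expSeq hb
  rw [raceLaw, lintegral_prod _ hF.aemeasurable, expSeq,
    lintegral_infinitePi_seqCons _ hF.lintegral_prod_right']
  refine lintegral_congr fun s => ?_
  rw [lintegral_prod _ (by fun_prop)]

lemma lintegral_raceLaw_seqCons_snd (ha : 0 < a) (hb : 0 < b) {F : Race → ℝ≥0∞}
    (hF : Measurable F) :
    ∫⁻ w, F w ∂raceLaw a b =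
      ∫⁻ t, ∫⁻ w, F (w.1, seqCons t w.2) ∂raceLaw a b ∂expMeasure b := by
  rw [← lintegral_raceLaw_swap hb ha hF,
    lintegral_raceLaw_seqCons_fst hb ha (F := fun w => F w.swap) (by fun_prop)]
  refine lintegral_congr fun t => ?_
  rw [← lintegral_raceLaw_swap hb ha (by fun_prop)]
  rfl

lemma lintegral_raceLaw_seqCons (ha : 0 < a) (hb : 0 < b) {F : Race → ℝ≥0∞} (hF : Measurable F) :
    ∫⁻ w, F w ∂raceLaw a b =
      ∫⁻ s, ∫⁻ t, ∫⁻ w, F (seqCons s w.1, seqCons t w.2) ∂raceLaw a b ∂expMeasure b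
        ∂expMeasure a := by
  rw [lintegral_raceLaw_seqCons_fst ha hb hF]
  refine lintegral_congr fun s => ?_
  rw [lintegral_raceLaw_seqCons_snd ha hb (by fun_prop)]

lemma ae_ne_raceLaw (ha : 0 < a) (hb : 0 < b) : ∀ᵐ w ∂raceLaw a b, w.1 0 ≠ w.2 0 := by
  have := isProbabilityMeasure_expSeq ha
  have := isProbabilityMeasure_expSeq hb
  rw [raceLaw, Measure.ae_prod_iff_ae_ae (p := fun w : Race => w.1 0 ≠ w.2 0)
    (measurableSet_eq_fun (by fun_prop) (by fun_prop)).compl]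
  refine .of_forall fun x => ?_
  have hlaw : ∀ᵐ t ∂(expSeq b).map fun y => y 0, x 0 ≠ t := by
    rw [map_eval_expSeq hb]
    filter_upwards [measure_eq_zero_iff_ae_notMem.mp (expMeasure_singleton b (x 0))] with t ht h
    exact ht h.symm
  exact ae_of_ae_map (measurable_pi_apply 0).aemeasurable hlaw

/-- The part of a race after its first block, provided that this block is one of the honest
miners. -/
def residualHonest (w : Race) : Race := (seqTail w.1, seqCons (w.2 0 - w.1 0) (seqTail w.2))

open Classical in
/-- The residual race, that is the part of a race after its first block. -/
noncomputable def residual (w : Race) : Race :=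
  if w.1 0 < w.2 0 then residualHonest w else (residualHonest w.swap).swap

open Classical in
/-- Whether the first block of the race is one of the honest miners. -/
noncomputable def honestFirst (w : Race) : Bool := decide (w.1 0 < w.2 0)

/-- The time of the first block of the race. -/
noncomputable def firstTime (w : Race) : ℝ := min (w.1 0) (w.2 0)

lemma measurableSet_fst_lt_snd : MeasurableSet {w : Race | w.1 0 < w.2 0} :=
  measurableSet_lt (by fun_prop) (by fun_prop)

@[fun_prop]
lemma measurable_residualHonest : Measurable residualHonest := by
  unfold residualHonest
  fun_prop

@[fun_prop]
lemma measurable_residual : Measurable residual :=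
  Measurable.ite measurableSet_fst_lt_snd measurable_residualHonest (by fun_prop)

@[fun_prop]
lemma measurable_honestFirst : Measurable honestFirst := by
  refine measurable_to_bool ?_
  convert measurableSet_fst_lt_snd using 1
  ext w
  simp [honestFirst]

@[fun_prop]
lemma measurable_firstTime : Measurable firstTime := by
  unfold firstTime
  fun_prop

lemma lintegral_fst_lt_snd (ha : 0 < a) (hb : 0 < b) {g : ℝ → ℝ≥0∞} (hg : Measurable g)
    {F : Race → ℝ≥0∞} (hF : Measurable F) :
    ∫⁻ w, {w : Race | w.1 0 < w.2 0}.indicator (fun w => g (w.1 0) * F (residualHonest w)) w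
        ∂raceLaw a b =
      ENNReal.ofReal (a / (a + b)) * (∫⁻ u, g u ∂expMeasure (a + b)) * ∫⁻ w, F w ∂raceLaw a b := by
  have := isProbabilityMeasure_raceLaw ha hb
  have hFcons : Measurable fun t => ∫⁻ w : Race, F (w.1, seqCons t w.2) ∂raceLaw a b :=
    Measurable.lintegral_prod_right'
      (f := fun x : ℝ × Race => F (x.2.1, seqCons x.1 x.2.2)) (by fun_prop)
  have hcons : ∀ s t, ∫⁻ w : Race, {w : Race | w.1 0 < w.2 0}.indicator
        (fun w => g (w.1 0) * F (residualHonest w)) (seqCons s w.1, seqCons t w.2) ∂raceLaw a b =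
      g s * (Set.Ioi s).indicator
        (fun t => ∫⁻ w : Race, F (w.1, seqCons (t - s) w.2) ∂raceLaw a b) t := by
    intro s t
    by_cases hst : s < t
    · simp only [Set.indicator, Set.mem_ofPred_eq, seqCons_zero, Set.mem_Ioi, hst, if_true,
        residualHonest, seqTail_seqCons]
      exact lintegral_const_mul _ (by fun_prop)
    · simp [Set.indicator, hst]
  have hmeas : Measurable fun w : Race => g (w.1 0) * F (residualHonest w) := by fun_prop
  rw [lintegral_raceLaw_seqCons ha hb (hmeas.indicator measurableSet_fst_lt_snd)]
  simp_rw [hcons]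
  rw [lintegral_raceLaw_seqCons_snd ha hb hF, ← lintegral_expMeasure_race ha hb hg hFcons]
  refine lintegral_congr fun s => lintegral_const_mul _ ?_
  exact (hFcons.comp (measurable_id.sub_const s)).indicator measurableSet_Ioi

theorem lintegral_renewal (ha : 0 < a) (hb : 0 < b) {g : ℝ → ℝ≥0∞} (hg : Measurable g)
    {F : Bool → Race → ℝ≥0∞} (hF : ∀ e, Measurable (F e)) :
    ∫⁻ w, g (firstTime w) * F (honestFirst w) (residual w) ∂raceLaw a b =
      (∫⁻ u, g u ∂expMeasure (a + b)) *
        (ENNReal.ofReal (a / (a + b)) * ∫⁻ w, F true w ∂raceLaw a b +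
          ENNReal.ofReal (b / (a + b)) * ∫⁻ w, F false w ∂raceLaw a b) := by
  set Φ : (Race → ℝ≥0∞) → Race → ℝ≥0∞ := fun F =>
    {w : Race | w.1 0 < w.2 0}.indicator fun w => g (w.1 0) * F (residualHonest w) with hΦ
  have hΦm : ∀ {F : Race → ℝ≥0∞}, Measurable F → Measurable (Φ F) := fun hF =>
    ((hg.comp (by fun_prop)).mul (hF.comp measurable_residualHonest)).indicator
      measurableSet_fst_lt_snd
  have hFswap : Measurable (F false ∘ Prod.swap) := (hF false).comp measurable_swap
  have hsplit : ∀ᵐ w ∂raceLaw a b, g (firstTime w) * F (honestFirst w) (residual w) =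
      Φ (F true) w + Φ (F false ∘ Prod.swap) w.swap := by
    filter_upwards [ae_ne_raceLaw ha hb] with w hw
    rcases lt_or_gt_of_ne hw with h | h <;>
      simp [hΦ, honestFirst, residual, firstTime, h, h.not_gt, h.le]
  rw [lintegral_congr_ae hsplit, lintegral_add_left (hΦm (hF true)),
    lintegral_raceLaw_swap ha hb (hΦm hFswap), lintegral_fst_lt_snd ha hb hg (hF true),
    lintegral_fst_lt_snd hb ha hg hFswap, add_comm b a,
    ← lintegral_raceLaw_swap hb ha (hF false)]
  simp only [Function.comp_apply]
  ring

lemma ofReal_div_add_ofReal_div (ha : 0 < a) (hb : 0 < b) :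
    ENNReal.ofReal (a / (a + b)) + ENNReal.ofReal (b / (a + b)) = 1 := by
  rw [← ENNReal.ofReal_add (by positivity) (by positivity), ← add_div, div_self (by positivity),
    ENNReal.ofReal_one]

lemma lintegral_firstTime (ha : 0 < a) (hb : 0 < b) :
    ∫⁻ w, ENNReal.ofReal (firstTime w) ∂raceLaw a b = ENNReal.ofReal (1 / (a + b)) := by
  have := isProbabilityMeasure_raceLaw ha hb
  have h := lintegral_renewal ha hb ENNReal.measurable_ofReal (F := fun _ _ => 1)
    fun _ => measurable_const
  simpa only [mul_one, lintegral_one, measure_univ, ofReal_div_add_ofReal_div ha hb,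
    lintegral_id_expMeasure (add_pos ha hb)] using h

lemma lintegral_residual (ha : 0 < a) (hb : 0 < b) {F : Bool → Race → ℝ≥0∞}
    (hF : ∀ e, Measurable (F e)) :
    ∫⁻ w, F (honestFirst w) (residual w) ∂raceLaw a b =
      ENNReal.ofReal (a / (a + b)) * ∫⁻ w, F true w ∂raceLaw a b +
        ENNReal.ofReal (b / (a + b)) * ∫⁻ w, F false w ∂raceLaw a b := by
  have := isProbabilityMeasure_expMeasure (add_pos ha hb)
  simpa only [one_mul, lintegral_one, measure_univ] using
    lintegral_renewal ha hb (g := fun _ => 1) measurable_const hF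

lemma measurePreserving_residual (ha : 0 < a) (hb : 0 < b) :
    MeasurePreserving residual (raceLaw a b) (raceLaw a b) := by
  refine ⟨measurable_residual, Measure.ext fun s hs => ?_⟩
  have hmeas : Measurable (s.indicator (1 : Race → ℝ≥0∞)) := measurable_one.indicator hs
  rw [← lintegral_indicator_one (μ := (raceLaw a b).map residual) hs,
    ← lintegral_indicator_one (μ := raceLaw a b) hs,
    lintegral_map hmeas measurable_residual,
    lintegral_residual ha hb (F := fun _ => s.indicator 1) fun _ => hmeas, ← add_mul,
    ofReal_div_add_ofReal_div ha hb, one_mul]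

end Renewal

section Games

variable {S : Type*}

/-- A game that is driven by the miners of the successive blocks of a race. The state moves by
`step s true` if the next block is one of the honest miners, and by `step s false` otherwise. The
game ends in the first stopped state; until then the player is paid for the time at the given rate,
and in this state he gets the reward. -/
structure Game (S : Type*) where
  step : S → Bool → S
  stopped : S → Prop
  rate : ℝ≥0
  reward : S → ℝ≥0

namespace Game

variable (G : Game S)

open Classical in
/-- The payoff of the game on a race when it is played for at most `n` blocks; there is no reward
if it has not ended by then. -/
noncomputable def payoff : ℕ → S → Race → ℝ≥0∞
  | 0, s, _ => if G.stopped s then G.reward s else 0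
  | n + 1, s, w => if G.stopped s then G.reward s else
      G.rate * ENNReal.ofReal (firstTime w) + payoff n (G.step s (honestFirst w)) (residual w)

open Classical in
/-- The expected payoff when the game is played for at most `n` blocks, each of which takes the time
`τ` on average and is one of the honest miners with probability `p`, of the attacker with
probability `q`. -/
noncomputable def meanPayoff (p q τ : ℝ) : ℕ → S → ℝ
  | 0, s => if G.stopped s then G.reward s else 0
  | n + 1, s => if G.stopped s then G.reward s else
      G.rate * τ +
        (p * meanPayoff p q τ n (G.step s true) + q * meanPayoff p q τ n (G.step s false))

/-- The one-step equations for the value `V` of the game, with `p`, `q`, `τ` as in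
`Game.meanPayoff`. -/
structure IsValue (p q τ : ℝ) (V : S → ℝ) : Prop where
  of_stopped : ∀ s, G.stopped s → V s = G.reward s
  of_not_stopped : ∀ s, ¬ G.stopped s →
    V s = G.rate * τ + (p * V (G.step s true) + q * V (G.step s false))

/-- `W` is a Lyapunov function of the game: it decreases in the mean by the factor `ρ < 1` with
every block. -/
structure IsLyapunov (p q ρ : ℝ) (W : S → ℝ) : Prop where
  factor_nonneg : 0 ≤ ρ
  factor_lt_one : ρ < 1
  nonneg : ∀ s, 0 ≤ W s
  step_le : ∀ s, ¬ G.stopped s → p * W (G.step s true) + q * W (G.step s false) ≤ ρ * W s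

variable {G} {n : ℕ} {s : S} {a b p q τ ρ C : ℝ} {V W : S → ℝ}

lemma payoff_of_stopped (h : G.stopped s) (w : Race) : G.payoff n s w = G.reward s := by
  cases n <;> simp [payoff, h]

lemma payoff_succ (h : ¬ G.stopped s) (w : Race) :
    G.payoff (n + 1) s w =
      G.rate * ENNReal.ofReal (firstTime w) +
        G.payoff n (G.step s (honestFirst w)) (residual w) := by
  simp [payoff, h]

lemma meanPayoff_of_stopped (h : G.stopped s) : G.meanPayoff p q τ n s = G.reward s := by
  cases n <;> simp [meanPayoff, h]

lemma meanPayoff_succ (h : ¬ G.stopped s) :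
    G.meanPayoff p q τ (n + 1) s =
      G.rate * τ + (p * G.meanPayoff p q τ n (G.step s true) +
        q * G.meanPayoff p q τ n (G.step s false)) := by
  simp [meanPayoff, h]

@[fun_prop]
lemma measurable_payoff (n : ℕ) (s : S) : Measurable (G.payoff n s) := by
  induction n generalizing s with
  | zero => exact measurable_const
  | succ n ih =>
    by_cases h : G.stopped s
    · simpa only [funext (payoff_of_stopped h)] using measurable_const
    · have hnext : Measurable fun x : Bool × Race => G.payoff n (G.step s x.1) x.2 :=
        measurable_from_prod_countable_right fun e => ih (G.step s e)
      simp only [funext (payoff_succ h)]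
      exact (measurable_firstTime.ennreal_ofReal.const_mul _).add
        (hnext.comp (measurable_honestFirst.prodMk measurable_residual))

lemma monotone_payoff (s : S) (w : Race) : Monotone fun n => G.payoff n s w := by
  refine monotone_nat_of_le_succ fun n => ?_
  induction n generalizing s w with
  | zero => by_cases h : G.stopped s <;> simp [payoff, h]
  | succ n ih =>
    by_cases h : G.stopped s
    · simp only [payoff_of_stopped h, le_refl]
    · simp only [payoff_succ h]
      gcongr
      exact ih _ _

lemma meanPayoff_nonneg (hp : 0 ≤ p) (hq : 0 ≤ q) (hτ : 0 ≤ τ) (n : ℕ) (s : S) :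
    0 ≤ G.meanPayoff p q τ n s := by
  induction n generalizing s with
  | zero => by_cases h : G.stopped s <;> simp [meanPayoff, h]
  | succ n ih =>
    by_cases h : G.stopped s
    · simp [meanPayoff_of_stopped h]
    · have htrue := ih (G.step s true)
      have hfalse := ih (G.step s false)
      rw [meanPayoff_succ h]
      positivity

lemma lintegral_payoff (ha : 0 < a) (hb : 0 < b) (n : ℕ) (s : S) :
    ∫⁻ w, G.payoff n s w ∂raceLaw a b =
      ENNReal.ofReal (G.meanPayoff (a / (a + b)) (b / (a + b)) (1 / (a + b)) n s) := by
  have := isProbabilityMeasure_raceLaw ha hb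
  induction n generalizing s with
  | zero => by_cases h : G.stopped s <;> simp [payoff, meanPayoff, h]
  | succ n ih =>
    by_cases h : G.stopped s
    · simp [payoff_of_stopped h, meanPayoff_of_stopped h]
    · have hnonneg := fun s => G.meanPayoff_nonneg (p := a / (a + b)) (q := b / (a + b))
        (τ := 1 / (a + b)) (by positivity) (by positivity) (by positivity) n s
      have htrue := hnonneg (G.step s true)
      have hfalse := hnonneg (G.step s false)
      simp only [payoff_succ h]
      rw [lintegral_add_left (by fun_prop), lintegral_const_mul _ (by fun_prop),
        lintegral_firstTime ha hb,
        lintegral_residual ha hb (F := fun e => G.payoff n (G.step s e)) fun e => by fun_prop,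
        ih, ih, meanPayoff_succ h, ENNReal.ofReal_add (by positivity) (by positivity),
        ENNReal.ofReal_add (by positivity) (by positivity), ENNReal.ofReal_mul (by positivity),
        ENNReal.ofReal_mul (by positivity), ENNReal.ofReal_mul (by positivity),
        ENNReal.ofReal_coe_nnreal]

lemma IsLyapunov.const_mul (hW : G.IsLyapunov p q ρ W) (hC : 0 ≤ C) :
    G.IsLyapunov p q ρ fun s => C * W s where
  factor_nonneg := hW.factor_nonneg
  factor_lt_one := hW.factor_lt_one
  nonneg s := mul_nonneg hC (hW.nonneg s)
  step_le s hs := by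
    have := mul_le_mul_of_nonneg_left (hW.step_le s hs) hC
    linarith

lemma abs_sub_meanPayoff_le (hp : 0 ≤ p) (hq : 0 ≤ q) (hV : G.IsValue p q τ V)
    (hW : G.IsLyapunov p q ρ W) (hVW : ∀ s, ¬ G.stopped s → |V s| ≤ W s) (n : ℕ) (s : S) :
    |V s - G.meanPayoff p q τ n s| ≤ ρ ^ n * W s := by
  have hρ := hW.factor_nonneg
  induction n generalizing s with
  | zero =>
    by_cases h : G.stopped s
    · simpa [meanPayoff_of_stopped h, hV.of_stopped s h] using hW.nonneg s
    · simpa [meanPayoff, h] using hVW s h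
  | succ n ih =>
    by_cases h : G.stopped s
    · simpa [meanPayoff_of_stopped h, hV.of_stopped s h] using
        mul_nonneg (pow_nonneg hρ (n + 1)) (hW.nonneg s)
    · set E : S → ℝ := fun s => V s - G.meanPayoff p q τ n s with hE
      calc |V s - G.meanPayoff p q τ (n + 1) s|
          = |p * E (G.step s true) + q * E (G.step s false)| := by
            rw [meanPayoff_succ h, hV.of_not_stopped s h, hE]
            congr 1
            ring
        _ ≤ p * |E (G.step s true)| + q * |E (G.step s false)| := by
            refine (abs_add_le _ _).trans_eq ?_
            rw [abs_mul, abs_mul, abs_of_nonneg hp, abs_of_nonneg hq]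
        _ ≤ p * (ρ ^ n * W (G.step s true)) + q * (ρ ^ n * W (G.step s false)) := by
            gcongr
            exacts [ih _, ih _]
        _ = ρ ^ n * (p * W (G.step s true) + q * W (G.step s false)) := by ring
        _ ≤ ρ ^ n * (ρ * W s) := by
            gcongr
            exact hW.step_le s h
        _ = ρ ^ (n + 1) * W s := by ring

lemma tendsto_meanPayoff (hp : 0 ≤ p) (hq : 0 ≤ q) (hV : G.IsValue p q τ V)
    (hW : G.IsLyapunov p q ρ W) (hVW : ∀ s, ¬ G.stopped s → |V s| ≤ W s) (s : S) :
    Filter.Tendsto (fun n => G.meanPayoff p q τ n s) Filter.atTop (nhds (V s)) := by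
  have hbound : Filter.Tendsto (fun n : ℕ => ρ ^ n * W s) Filter.atTop (nhds 0) := by
    simpa using (tendsto_pow_atTop_nhds_zero_of_lt_one hW.factor_nonneg hW.factor_lt_one).mul_const
      (W s)
  rw [tendsto_iff_dist_tendsto_zero]
  refine squeeze_zero (fun _ => dist_nonneg) (fun n => ?_) hbound
  rw [dist_comm, Real.dist_eq]
  exact abs_sub_meanPayoff_le hp hq hV hW hVW n s

theorem lintegral_iSup_payoff (ha : 0 < a) (hb : 0 < b)
    (hV : G.IsValue (a / (a + b)) (b / (a + b)) (1 / (a + b)) V)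
    (hW : G.IsLyapunov (a / (a + b)) (b / (a + b)) ρ W)
    (hVW : ∀ s, ¬ G.stopped s → |V s| ≤ W s) (s : S) :
    0 ≤ V s ∧ ∫⁻ w, ⨆ n, G.payoff n s w ∂raceLaw a b = ENNReal.ofReal (V s) := by
  have hlim := tendsto_meanPayoff (by positivity) (by positivity) hV hW hVW s
  refine ⟨ge_of_tendsto' hlim fun n => meanPayoff_nonneg (by positivity) (by positivity)
    (by positivity) n s, ?_⟩
  rw [lintegral_iSup (fun n => measurable_payoff n s) fun i j hij w => monotone_payoff s w hij]
  refine iSup_eq_of_tendsto (fun i j hij => lintegral_mono fun w => monotone_payoff s w hij) ?_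
  simpa only [lintegral_payoff ha hb] using ENNReal.tendsto_ofReal hlim

variable (G) in
/-- The game that starts in the state `s` ends with one of the next `n` blocks of the race. -/
def EndsWithin : ℕ → S → Race → Prop
  | 0, s, _ => G.stopped s
  | n + 1, s, w => G.stopped s ∨ EndsWithin n (G.step s (honestFirst w)) (residual w)

lemma payoff_of_endsWithin {w : Race} {k : ℕ} (h : G.EndsWithin n s w) (hnk : n ≤ k) :
    G.payoff k s w = G.payoff n s w := by
  induction n generalizing s w k with
  | zero => rw [payoff_of_stopped h, payoff_of_stopped h]
  | succ n ih =>
    obtain ⟨k, rfl⟩ := Nat.exists_eq_add_one.mpr (Nat.zero_lt_of_lt hnk)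
    by_cases hs : G.stopped s
    · rw [payoff_of_stopped hs, payoff_of_stopped hs]
    · rw [payoff_succ hs, payoff_succ hs, ih (h.resolve_left hs) (Nat.le_of_succ_le_succ hnk)]

lemma iSup_payoff_of_endsWithin {w : Race} (h : G.EndsWithin n s w) :
    ⨆ k, G.payoff k s w = G.payoff n s w := by
  refine le_antisymm (iSup_le fun k => ?_) (le_iSup (fun k => G.payoff k s w) n)
  rcases le_total k n with hkn | hnk
  · exact monotone_payoff s w hkn
  · exact (payoff_of_endsWithin h hnk).le

variable (G) in
/-- The game in which the player gets nothing but the reward `1` at the end of `G`. Its value is the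
probability that `G` ends. -/
def ending : Game S := { G with rate := 0, reward := fun _ => 1 }

open Classical in
lemma payoff_ending (n : ℕ) (s : S) (w : Race) :
    G.ending.payoff n s w = if G.EndsWithin n s w then 1 else 0 := by
  induction n generalizing s w with
  | zero => by_cases hs : G.stopped s <;> simp [payoff, ending, EndsWithin, hs]
  | succ n ih =>
    by_cases hs : G.stopped s
    · rw [payoff_of_stopped (G := G.ending) hs]
      simp [ending, EndsWithin, hs]
    · rw [payoff_succ (G := G.ending) hs, ih]
      by_cases h : G.EndsWithin n (G.step s (honestFirst w)) (residual w) <;>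
        simp [ending, EndsWithin, hs, h]

theorem ae_endsWithin (ha : 0 < a) (hb : 0 < b)
    (hW : G.IsLyapunov (a / (a + b)) (b / (a + b)) ρ W) (hW1 : ∀ s, ¬ G.stopped s → 1 ≤ W s)
    (s : S) : ∀ᵐ w ∂raceLaw a b, ∃ n, G.EndsWithin n s w := by
  have := isProbabilityMeasure_raceLaw ha hb
  have hV : G.ending.IsValue (a / (a + b)) (b / (a + b)) (1 / (a + b)) fun _ => 1 :=
    ⟨fun _ _ => by simp [ending],
      fun _ _ => by simp only [ending, NNReal.coe_zero]; field_simp; simp⟩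
  have hL : G.ending.IsLyapunov (a / (a + b)) (b / (a + b)) ρ W :=
    ⟨hW.factor_nonneg, hW.factor_lt_one, hW.nonneg, hW.step_le⟩
  obtain ⟨-, hint⟩ := lintegral_iSup_payoff ha hb hV hL (fun s hs => by simpa using hW1 s hs) s
  have hle : ∀ w, ⨆ n, G.ending.payoff n s w ≤ 1 := fun w => iSup_le fun n => by
    rw [payoff_ending]
    split_ifs <;> simp
  have hae : ∀ᵐ w ∂raceLaw a b, ⨆ n, G.ending.payoff n s w = 1 :=
    ae_eq_of_ae_le_of_lintegral_le (.of_forall hle) (by simp [hint]) aemeasurable_const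
      (by simp [hint])
  filter_upwards [hae] with w hw
  by_contra! hno
  simp [payoff_ending, hno] at hw

end Game

end Games

section Counting

/-- The number of blocks discovered up to time `t`, given the times `x` between them. -/
noncomputable def seqCount (x : ℕ → ℝ) (t : ℝ) : ℕ :=
  {n : ℕ | ∑ i ∈ Finset.range (n + 1), x i ≤ t}.ncard

variable {x : ℕ → ℝ} {t : ℝ}

lemma seqCount_of_lt (hx : ∀ i, 0 < x i) (ht : t < x 0) : seqCount x t = 0 := by
  have hempty : {n : ℕ | ∑ i ∈ Finset.range (n + 1), x i ≤ t} = ∅ := by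
    refine Set.eq_empty_of_forall_notMem fun n hn => ?_
    have hle : x 0 ≤ ∑ i ∈ Finset.range (n + 1), x i :=
      Finset.single_le_sum (fun i _ => (hx i).le) (by simp)
    exact absurd (hle.trans hn) (not_le.mpr ht)
  rw [seqCount, hempty, Set.ncard_empty]

lemma seqCount_of_le (hfin : {n : ℕ | ∑ i ∈ Finset.range (n + 1), x i ≤ t}.Finite)
    (ht : x 0 ≤ t) : seqCount x t = 1 + seqCount (seqTail x) (t - x 0) := by
  have hshift : {n : ℕ | ∑ i ∈ Finset.range (n + 1), x i ≤ t} =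
      insert 0 (Nat.succ '' {n : ℕ | ∑ i ∈ Finset.range (n + 1), seqTail x i ≤ t - x 0}) := by
    ext n
    cases n with
    | zero => simpa using ht
    | succ n => simp [Finset.sum_range_succ' x (n + 1), le_sub_iff_add_le, seqTail]
  rw [seqCount, hshift, Set.ncard_insert_of_notMem (by simp)
    (hfin.subset (by rw [hshift]; exact Set.subset_insert _ _)),
    Set.ncard_image_of_injective _ Nat.succ_injective, add_comm]
  rfl

lemma seqCount_seqCons_sub (x : ℕ → ℝ) (t u : ℝ) :
    seqCount (seqCons (x 0 - u) (seqTail x)) (t - u) = seqCount x t := by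
  simp only [seqCount, Finset.sum_range_succ', seqCons_succ, seqCons_zero, seqTail, ← add_sub_assoc,
    sub_le_sub_iff_right]

end Counting

section Cycles

/-- The times between successive blocks are positive, the first two blocks of the two sides are not
simultaneous, and finitely many blocks are discovered in a bounded time. -/
structure IsRegular (w : Race) : Prop where
  pos_fst : ∀ i, 0 < w.1 i
  pos_snd : ∀ i, 0 < w.2 i
  ne : w.1 0 ≠ w.2 0
  finite_fst : ∀ t, {n : ℕ | ∑ i ∈ Finset.range (n + 1), w.1 i ≤ t}.Finite
  finite_snd : ∀ t, {n : ℕ | ∑ i ∈ Finset.range (n + 1), w.2 i ≤ t}.Finite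

/-- The state of an attack cycle: `none` during the pre-mining, and afterwards the number of
confirmations and the length of the secret fork. -/
abbrev CycleState := Option (ℕ × ℕ)

/-- The state of an attack cycle after a block of the honest miners (`true`) or of the attacker
(`false`). -/
def cycleStep : CycleState → Bool → CycleState
  | none, true => none
  | none, false => some (0, 1)
  | some (h, f), true => some (h + 1, f)
  | some (h, f), false => some (h, f + 1)

/-- The states in which an attack cycle ends. -/
def CycleEnds (A z : ℕ) : CycleState → Prop
  | none => False
  | some (h, f) => A + f ≤ h ∨ (z ≤ h ∧ h < f)

/-- The attack cycle as a game with the reward `ρ h f` if the cycle ends with `h` confirmations and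
a secret fork of length `f`. -/
def cycleGame (A z : ℕ) (c : ℝ≥0) (ρ : ℤ → ℤ → ℝ≥0) : Game CycleState where
  step := cycleStep
  stopped := CycleEnds A z
  rate := c
  reward
    | none => 0
    | some (h, f) => ρ h f

/-- The confirmations at time `t` of a cycle that is in the state `s` at time `0`. -/
noncomputable def raceConf (s : CycleState) (w : Race) (t : ℝ) : ℤ :=
  match s with
  | none => (seqCount w.1 t : ℤ) - seqCount w.1 (w.2 0)
  | some (h, _) => h + seqCount w.1 t

/-- The length of the secret fork at time `t` of a cycle that is in the state `s` at time `0`. -/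
noncomputable def raceFork (s : CycleState) (w : Race) (t : ℝ) : ℤ :=
  match s with
  | none => 1 + ((seqCount w.2 t : ℤ) - seqCount w.2 (w.2 0))
  | some (_, f) => f + seqCount w.2 t

/-- The launch time of a cycle that is in the state `s` at time `0`. -/
noncomputable def raceStart (s : CycleState) (w : Race) : ℝ :=
  match s with
  | none => w.2 0
  | some _ => 0

/-- The times that end a cycle that is in the state `s` at time `0`. -/
def raceEnd (A z : ℕ) (s : CycleState) (w : Race) : Set ℝ :=
  {t | raceStart s w ≤ t ∧ ((A : ℤ) ≤ raceConf s w t - raceFork s w t ∨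
    ((z : ℤ) ≤ raceConf s w t ∧ raceConf s w t - raceFork s w t < 0))}

/-- The duration of a cycle that is in the state `s` at time `0`. -/
noncomputable def raceDuration (A z : ℕ) (s : CycleState) (w : Race) : ℝ :=
  sInf (raceEnd A z s w)

variable {w : Race} {t : ℝ} {A z n : ℕ} {s : CycleState} {c : ℝ≥0} {ρ : ℤ → ℤ → ℝ≥0}

lemma residual_of_lt (h : w.1 0 < w.2 0) :
    residual w = (seqTail w.1, seqCons (w.2 0 - w.1 0) (seqTail w.2)) := by
  simp [residual, h, residualHonest]

lemma residual_of_gt (h : w.2 0 < w.1 0) :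
    residual w = (seqCons (w.1 0 - w.2 0) (seqTail w.1), seqTail w.2) := by
  simp [residual, h.le.not_gt, residualHonest]

lemma honestFirst_of_lt (h : w.1 0 < w.2 0) : honestFirst w = true := by simp [honestFirst, h]

lemma honestFirst_of_gt (h : w.2 0 < w.1 0) : honestFirst w = false := by
  simp [honestFirst, h.le]

lemma firstTime_of_lt (h : w.1 0 < w.2 0) : firstTime w = w.1 0 := min_eq_left h.le

lemma firstTime_of_gt (h : w.2 0 < w.1 0) : firstTime w = w.2 0 := min_eq_right h.le

lemma IsRegular.firstTime_pos (hw : IsRegular w) : 0 < firstTime w :=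
  lt_min (hw.pos_fst 0) (hw.pos_snd 0)

lemma IsRegular.seqCount_fst_of_lt (hw : IsRegular w) (ht : t < firstTime w) :
    seqCount w.1 t = 0 :=
  seqCount_of_lt hw.pos_fst (ht.trans_le (min_le_left _ _))

lemma IsRegular.seqCount_snd_of_lt (hw : IsRegular w) (ht : t < firstTime w) :
    seqCount w.2 t = 0 :=
  seqCount_of_lt hw.pos_snd (ht.trans_le (min_le_right _ _))

lemma IsRegular.seqCount_fst_residual (hw : IsRegular w) (ht : firstTime w ≤ t) :
    seqCount w.1 t = (honestFirst w).toNat + seqCount (residual w).1 (t - firstTime w) := by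
  rcases lt_or_gt_of_ne hw.ne with h | h
  · rw [firstTime_of_lt h] at ht ⊢
    simp [honestFirst_of_lt h, residual_of_lt h, seqCount_of_le (hw.finite_fst t) ht]
  · simp [firstTime_of_gt h, honestFirst_of_gt h, residual_of_gt h, seqCount_seqCons_sub]

lemma IsRegular.seqCount_snd_residual (hw : IsRegular w) (ht : firstTime w ≤ t) :
    seqCount w.2 t = (!honestFirst w).toNat + seqCount (residual w).2 (t - firstTime w) := by
  rcases lt_or_gt_of_ne hw.ne with h | h
  · simp [firstTime_of_lt h, honestFirst_of_lt h, residual_of_lt h, seqCount_seqCons_sub]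
  · rw [firstTime_of_gt h] at ht ⊢
    simp [honestFirst_of_gt h, residual_of_gt h, seqCount_of_le (hw.finite_snd t) ht]

lemma raceConf_residual (hw : IsRegular w) (hw' : IsRegular (residual w)) (s : CycleState)
    (ht : firstTime w ≤ t) :
    raceConf (cycleStep s (honestFirst w)) (residual w) (t - firstTime w) = raceConf s w t := by
  rcases s with _ | ⟨k, f⟩
  · have hlaunch : firstTime w ≤ w.2 0 := min_le_right _ _
    rw [raceConf, hw.seqCount_fst_residual ht, hw.seqCount_fst_residual hlaunch]
    rcases lt_or_gt_of_ne hw.ne with h | h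
    · simp [honestFirst_of_lt h, residual_of_lt h, firstTime_of_lt h, cycleStep, raceConf]
    · simp [honestFirst_of_gt h, firstTime_of_gt h, cycleStep, raceConf,
        hw'.seqCount_fst_of_lt hw'.firstTime_pos]
  · rw [raceConf, hw.seqCount_fst_residual ht]
    cases honestFirst w <;> simp only [cycleStep, raceConf, Bool.toNat_true, Bool.toNat_false] <;>
      push_cast <;> ring

lemma raceFork_residual (hw : IsRegular w) (hw' : IsRegular (residual w)) (s : CycleState)
    (ht : firstTime w ≤ t) :
    raceFork (cycleStep s (honestFirst w)) (residual w) (t - firstTime w) = raceFork s w t := by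
  rcases s with _ | ⟨k, f⟩
  · have hlaunch : firstTime w ≤ w.2 0 := min_le_right _ _
    rw [raceFork, hw.seqCount_snd_residual ht, hw.seqCount_snd_residual hlaunch]
    rcases lt_or_gt_of_ne hw.ne with h | h
    · simp [honestFirst_of_lt h, residual_of_lt h, firstTime_of_lt h, cycleStep, raceFork]
    · simp [honestFirst_of_gt h, firstTime_of_gt h, cycleStep, raceFork,
        hw'.seqCount_snd_of_lt hw'.firstTime_pos]
  · rw [raceFork, hw.seqCount_snd_residual ht]
    cases honestFirst w <;> simp only [cycleStep, raceFork, Bool.not_true, Bool.not_false,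
      Bool.toNat_true, Bool.toNat_false] <;> push_cast <;> ring

lemma raceStart_residual (hw : IsRegular w) (s : CycleState) (ht : firstTime w ≤ t) :
    raceStart (cycleStep s (honestFirst w)) (residual w) ≤ t - firstTime w ↔
      raceStart s w ≤ t := by
  have ht0 : 0 ≤ t := hw.firstTime_pos.le.trans ht
  rcases lt_or_gt_of_ne hw.ne with h | h
  · rw [firstTime_of_lt h] at ht ⊢
    rcases s with _ | s <;>
      simp [honestFirst_of_lt h, residual_of_lt h, cycleStep, raceStart, ht, ht0]
  · rw [firstTime_of_gt h] at ht ⊢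
    rcases s with _ | s <;>
      simp [honestFirst_of_gt h, cycleStep, raceStart, ht, ht0]

lemma raceStart_nonneg (hw : IsRegular w) (s : CycleState) : 0 ≤ raceStart s w := by
  rcases s with _ | _
  exacts [(hw.pos_snd 0).le, le_rfl]

lemma bddBelow_raceEnd (hw : IsRegular w) : BddBelow (raceEnd A z s w) :=
  ⟨0, fun _ ht => (raceStart_nonneg hw s).trans ht.1⟩

lemma raceDuration_nonneg (hw : IsRegular w) : 0 ≤ raceDuration A z s w :=
  Real.sInf_nonneg fun _ ht => (raceStart_nonneg hw s).trans ht.1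

lemma firstTime_le_of_mem_raceEnd (hw : IsRegular w) (hs : ¬ CycleEnds A z s)
    (ht : t ∈ raceEnd A z s w) : firstTime w ≤ t := by
  by_contra! hlt
  rcases s with _ | ⟨h, f⟩
  · exact absurd (ht.1.trans_lt hlt) (not_lt.mpr (min_le_right _ _))
  · have hend := ht.2
    simp only [raceConf, raceFork, hw.seqCount_fst_of_lt hlt, hw.seqCount_snd_of_lt hlt] at hend
    exact hs (by simp only [CycleEnds]; omega)

lemma raceEnd_eq_image (hw : IsRegular w) (hw' : IsRegular (residual w)) (hs : ¬ CycleEnds A z s) :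
    raceEnd A z s w = (fun t => firstTime w + t) ''
      raceEnd A z (cycleStep s (honestFirst w)) (residual w) := by
  have hshift : ∀ t, firstTime w ≤ t → (t ∈ raceEnd A z s w ↔
      t - firstTime w ∈ raceEnd A z (cycleStep s (honestFirst w)) (residual w)) := by
    intro t ht
    simp only [raceEnd, Set.mem_ofPred_eq, raceConf_residual hw hw' s ht,
      raceFork_residual hw hw' s ht, raceStart_residual hw s ht]
  ext t
  constructor
  · intro ht
    exact ⟨t - firstTime w, (hshift t (firstTime_le_of_mem_raceEnd hw hs ht)).mp ht, by simp⟩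
  · rintro ⟨u, hu, rfl⟩
    have hu0 : 0 ≤ u := (raceStart_nonneg hw' _).trans hu.1
    exact (hshift _ (by linarith)).mpr (by simpa using hu)

lemma raceDuration_of_not_ends (hw : IsRegular w) (hw' : IsRegular (residual w))
    (hs : ¬ CycleEnds A z s)
    (hne : (raceEnd A z (cycleStep s (honestFirst w)) (residual w)).Nonempty) :
    raceDuration A z s w = firstTime w +
      raceDuration A z (cycleStep s (honestFirst w)) (residual w) := by
  rw [raceDuration, raceEnd_eq_image hw hw' hs]
  exact ((OrderIso.addLeft (firstTime w)).map_csInf' hne (bddBelow_raceEnd hw')).symm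

lemma zero_mem_raceEnd (hw : IsRegular w) (hs : CycleEnds A z s) : (0 : ℝ) ∈ raceEnd A z s w := by
  rcases s with _ | ⟨h, f⟩
  · exact hs.elim
  · refine ⟨le_rfl, ?_⟩
    simp only [raceConf, raceFork, hw.seqCount_fst_of_lt hw.firstTime_pos,
      hw.seqCount_snd_of_lt hw.firstTime_pos]
    simp only [CycleEnds] at hs
    omega

lemma raceDuration_of_ends (hw : IsRegular w) (hs : CycleEnds A z s) : raceDuration A z s w = 0 :=
  le_antisymm (csInf_le (bddBelow_raceEnd hw) (zero_mem_raceEnd hw hs)) (raceDuration_nonneg hw)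

lemma nonempty_raceEnd (hw : ∀ k, IsRegular (residual^[k] w))
    (h : (cycleGame A z c ρ).EndsWithin n s w) : (raceEnd A z s w).Nonempty := by
  induction n generalizing s w with
  | zero => exact ⟨0, zero_mem_raceEnd (hw 0) h⟩
  | succ n ih =>
    by_cases hs : CycleEnds A z s
    · exact ⟨0, zero_mem_raceEnd (hw 0) hs⟩
    · rw [raceEnd_eq_image (w := w) (hw 0) (hw 1) hs]
      exact (ih (fun k => hw (k + 1)) (h.resolve_left hs)).image _

lemma payoff_cycleGame_of_ends (hw : IsRegular w) (hs : CycleEnds A z s) :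
    (cycleGame A z c ρ).payoff n s w = c * ENNReal.ofReal (raceDuration A z s w) +
      ρ (raceConf s w (raceDuration A z s w)) (raceFork s w (raceDuration A z s w)) := by
  rw [Game.payoff_of_stopped (G := cycleGame A z c ρ) hs, raceDuration_of_ends hw hs]
  rcases s with _ | ⟨h, f⟩
  · exact hs.elim
  · simp [cycleGame, raceConf, raceFork, hw.seqCount_fst_of_lt hw.firstTime_pos,
      hw.seqCount_snd_of_lt hw.firstTime_pos]

theorem payoff_cycleGame (hw : ∀ k, IsRegular (residual^[k] w))
    (h : (cycleGame A z c ρ).EndsWithin n s w) :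
    (cycleGame A z c ρ).payoff n s w = c * ENNReal.ofReal (raceDuration A z s w) +
      ρ (raceConf s w (raceDuration A z s w)) (raceFork s w (raceDuration A z s w)) := by
  induction n generalizing s w with
  | zero => exact payoff_cycleGame_of_ends (hw 0) h
  | succ n ih =>
    have hw0 : IsRegular w := hw 0
    have hw1 : IsRegular (residual w) := hw 1
    by_cases hs : CycleEnds A z s
    · exact payoff_cycleGame_of_ends hw0 hs
    · have hres : ∀ k, IsRegular (residual^[k] (residual w)) := fun k => hw (k + 1)
      have hend := h.resolve_left hs
      have hD := raceDuration_of_not_ends hw0 hw1 hs (nonempty_raceEnd hres hend)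
      have hD0 := raceDuration_nonneg (A := A) (z := z) (s := cycleStep s (honestFirst w)) hw1
      have hle : firstTime w ≤ raceDuration A z s w := by linarith
      rw [Game.payoff_succ (G := cycleGame A z c ρ) hs, ih hres hend,
        ← raceConf_residual hw0 hw1 s hle, ← raceFork_residual hw0 hw1 s hle, hD,
        add_sub_cancel_left, ENNReal.ofReal_add hw0.firstTime_pos.le hD0, mul_add, add_assoc]
      rfl

end Cycles

section Regularity

variable {a b r : ℝ}

lemma ae_expSeq_pos (hr : 0 < r) : ∀ᵐ x ∂expSeq r, ∀ i, 0 < x i := by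
  refine ae_all_iff.mpr fun i => ?_
  have hpos : ∀ᵐ t ∂(expSeq r).map fun x => x i, 0 < t := by
    rw [map_eval_expSeq hr]
    exact ae_expMeasure_pos r
  exact ae_of_ae_map (measurable_pi_apply i).aemeasurable hpos

lemma ae_expSeq_tendsto_average (hr : 0 < r) :
    ∀ᵐ x : ℕ → ℝ ∂expSeq r,
      Filter.Tendsto (fun n : ℕ => (∑ i ∈ Finset.range n, x i) / (n : ℝ)) Filter.atTop
        (nhds (1 / r)) := by
  have := isProbabilityMeasure_expMeasure hr
  have hm : ∀ i, Measurable fun x : ℕ → ℝ => x i := measurable_pi_apply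
  have hindep : iIndepFun (fun i (x : ℕ → ℝ) => x i) (expSeq r) :=
    iIndepFun_infinitePi (P := fun _ : ℕ => expMeasure r) (X := fun _ t => t) fun _ => measurable_id
  have hint : Integrable (fun x : ℕ → ℝ => x 0) (expSeq r) := by
    have h := integrable_id_expMeasure hr
    rw [← map_eval_expSeq hr 0] at h
    exact h.comp_measurable (hm 0)
  have hmean : ∫ x, x 0 ∂expSeq r = 1 / r := by
    rw [← integral_id_expMeasure hr, ← map_eval_expSeq hr 0, integral_map (hm 0).aemeasurable
      measurable_id'.aestronglyMeasurable]
  have hslln := strong_law_ae_real (fun i (x : ℕ → ℝ) => x i) hint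
    (fun i j hij => hindep.indepFun hij) fun i =>
    ⟨(hm i).aemeasurable, (hm 0).aemeasurable, by rw [map_eval_expSeq hr, map_eval_expSeq hr]⟩
  rwa [hmean] at hslln

lemma ae_expSeq_finite (hr : 0 < r) :
    ∀ᵐ x ∂expSeq r, ∀ t : ℝ, {n : ℕ | ∑ i ∈ Finset.range (n + 1), x i ≤ t}.Finite := by
  filter_upwards [ae_expSeq_tendsto_average hr] with x hx t
  have htop : Filter.Tendsto (fun n : ℕ => ∑ i ∈ Finset.range n, x i) Filter.atTop
      Filter.atTop := by
    refine (hx.pos_mul_atTop (by positivity) tendsto_natCast_atTop_atTop).congr' ?_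
    filter_upwards [Filter.eventually_ne_atTop 0] with n hn
    exact div_mul_cancel₀ _ (Nat.cast_ne_zero.mpr hn)
  have hev := ((Filter.tendsto_add_atTop_iff_nat 1).mpr htop).eventually_gt_atTop t
  rw [← Nat.cofinite_eq_atTop, Filter.eventually_cofinite] at hev
  simpa only [not_lt] using hev

lemma ae_isRegular (ha : 0 < a) (hb : 0 < b) : ∀ᵐ w ∂raceLaw a b, IsRegular w := by
  have := isProbabilityMeasure_expSeq ha
  have := isProbabilityMeasure_expSeq hb
  have hfst := (Measure.quasiMeasurePreserving_fst (μ := expSeq a) (ν := expSeq b)).ae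
    ((ae_expSeq_pos ha).and (ae_expSeq_finite ha))
  have hsnd := (Measure.quasiMeasurePreserving_snd (μ := expSeq a) (ν := expSeq b)).ae
    ((ae_expSeq_pos hb).and (ae_expSeq_finite hb))
  filter_upwards [hfst, hsnd, ae_ne_raceLaw ha hb] with w hfst hsnd hne
  exact ⟨hfst.1, hsnd.1, hne, hfst.2, hsnd.2⟩

lemma ae_isRegular_iterate (ha : 0 < a) (hb : 0 < b) :
    ∀ᵐ w ∂raceLaw a b, ∀ k, IsRegular (residual^[k] w) :=
  ae_all_iff.mpr fun k =>
    ((measurePreserving_residual ha hb).iterate k).quasiMeasurePreserving.ae (ae_isRegular ha hb)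

end Regularity

section Law

variable {Ω : Type*} {X Y : ℕ → Ω → ℝ} {a b p q τ₀ : ℝ}

/-- The race between the honest miners and the attacker in the sample point `ω`. -/
def sampleRace (X Y : ℕ → Ω → ℝ) (ω : Ω) : Race := (fun i => X i ω, fun i => Y i ω)

@[fun_prop]
lemma measurable_sumElim_race : Measurable fun w : Race => (Sum.elim w.1 w.2 : ℕ ⊕ ℕ → ℝ) := by
  refine measurable_pi_iff.mpr ?_
  rintro (i | i) <;> simp only [Sum.elim_inl, Sum.elim_inr] <;> fun_prop

lemma isProbabilityMeasure_sumElim_expMeasure (ha : 0 < a) (hb : 0 < b) (i : ℕ ⊕ ℕ) :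
    IsProbabilityMeasure
      ((Sum.elim (fun _ => expMeasure a) fun _ => expMeasure b : ℕ ⊕ ℕ → Measure ℝ) i) := by
  rcases i with _ | _
  exacts [isProbabilityMeasure_expMeasure ha, isProbabilityMeasure_expMeasure hb]

lemma map_sumElim_raceLaw (ha : 0 < a) (hb : 0 < b) :
    (raceLaw a b).map (fun w => (Sum.elim w.1 w.2 : ℕ ⊕ ℕ → ℝ)) =
      Measure.infinitePi (Sum.elim (fun _ => expMeasure a) fun _ => expMeasure b) := by
  have := isProbabilityMeasure_expMeasure ha
  have := isProbabilityMeasure_expMeasure hb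
  have := isProbabilityMeasure_expSeq hb
  have := isProbabilityMeasure_sumElim_expMeasure ha hb
  refine Measure.eq_infinitePi _ fun s t ht => ?_
  have hpre : (fun w : Race => (Sum.elim w.1 w.2 : ℕ ⊕ ℕ → ℝ)) ⁻¹' Set.pi s t =
      (Set.pi s.toLeft fun i => t (Sum.inl i)) ×ˢ (Set.pi s.toRight fun i => t (Sum.inr i)) := by
    ext w
    simp [Set.mem_pi]
  rw [Measure.map_apply measurable_sumElim_race (MeasurableSet.pi s.countable_toSet
      fun i _ => ht i), hpre, raceLaw, Measure.prod_prod, expSeq, expSeq,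
    Measure.infinitePi_pi _ (fun i _ => ht _), Measure.infinitePi_pi _ (fun i _ => ht _)]
  conv_rhs => rw [← Finset.toLeft_disjSum_toRight (u := s), Finset.prod_disjSum]
  rfl

variable [MeasurableSpace Ω] {μ : Measure Ω}

lemma IsMiningRace.aemeasurable_sampleRace (h : IsMiningRace μ p q τ₀ X Y) :
    AEMeasurable (sampleRace X Y) μ :=
  (aemeasurable_pi_iff.mpr fun i => (h.honest_law i).aemeasurable).prodMk
    (aemeasurable_pi_iff.mpr fun i => (h.attacker_law i).aemeasurable)

theorem IsMiningRace.map_sampleRace (h : IsMiningRace μ p q τ₀ X Y) (ha : 0 < p / τ₀)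
    (hb : 0 < q / τ₀) : μ.map (sampleRace X Y) = raceLaw (p / τ₀) (q / τ₀) := by
  have := isProbabilityMeasure_sumElim_expMeasure ha hb
  have hlaw : ∀ i : ℕ ⊕ ℕ, HasLaw (Sum.elim X Y i)
      ((Sum.elim (fun _ => expMeasure (p / τ₀)) fun _ => expMeasure (q / τ₀) :
        ℕ ⊕ ℕ → Measure ℝ) i) μ := by
    rintro (i | i)
    exacts [h.honest_law i, h.attacker_law i]
  have hae : AEMeasurable (fun ω i => Sum.elim X Y i ω) μ :=
    aemeasurable_pi_iff.mpr fun i => (hlaw i).aemeasurable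
  set split : (ℕ ⊕ ℕ → ℝ) → Race := fun g => (fun i => g (Sum.inl i), fun i => g (Sum.inr i))
  have hm : Measurable split := by fun_prop
  have hjoint := congrArg (Measure.map split) (h.indep.hasLaw_infinitePi hlaw hae).map_eq
  rw [← map_sumElim_raceLaw ha hb, AEMeasurable.map_map_of_aemeasurable hm.aemeasurable hae,
    Measure.map_map hm measurable_sumElim_race] at hjoint
  exact hjoint.trans Measure.map_id

end Law

section Lyapunov

variable {p q γ : ℝ} {A z : ℕ} {c : ℝ≥0} {ρ : ℤ → ℤ → ℝ≥0}

/-- The length of the secret fork in a state of an attack cycle. -/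
def forkLength : CycleState → ℕ
  | none => 0
  | some (_, f) => f

/-- A Lyapunov function of the attack cycle. With the weights `α` for a block of the honest miners
and `β` for a block of the attacker, `α ^ h * β ^ f` decreases in the mean if `p * α + q * β < 1`,
and it dominates `f` as long as the attacker does not give up if `α < 1 < α * β`. -/
noncomputable def cycleLyapunov (p q : ℝ) : CycleState → ℝ
  | none => 2 * (p + 1 / (4 * q))
  | some (h, f) => (1 / (2 * p)) ^ h * (p + 1 / (4 * q)) ^ f

lemma mul_lt_one_fourth (hpq : p + q = 1) (hqp : q < p) : p * q < 1 / 4 := by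
  obtain rfl : p = 1 - q := by linarith
  nlinarith [sq_pos_of_pos (sub_pos.mpr hqp)]

lemma isLyapunov_cycleLyapunov (hpq : p + q = 1) (hq : 0 < q) (hqp : q < p) :
    (cycleGame A z c ρ).IsLyapunov p q (max (p * q + 3 / 4) ((1 + p) / 2)) (cycleLyapunov p q) where
  factor_nonneg := le_max_of_le_right (by linarith)
  factor_lt_one := max_lt (by linarith [mul_lt_one_fourth hpq hqp]) (by linarith)
  nonneg s := by
    have hp : 0 < p := hq.trans hqp
    rcases s with _ | ⟨h, f⟩ <;> simp only [cycleLyapunov] <;> positivity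
  step_le s _ := by
    have hp : 0 < p := hq.trans hqp
    obtain rfl : q = 1 - p := by linarith
    rcases s with _ | ⟨h, f⟩
    · calc _ = (1 + p) / 2 * (2 * (p + 1 / (4 * (1 - p)))) := by
            simp only [cycleGame, cycleStep, cycleLyapunov]
            ring
        _ ≤ _ := by
            simp only [cycleLyapunov]
            gcongr
            exact le_max_right _ _
    · calc _ = (p * (1 - p) + 3 / 4) * ((1 / (2 * p)) ^ h * (p + 1 / (4 * (1 - p))) ^ f) := by
            have hα : p * (1 / (2 * p)) = 1 / 2 := by field_simp
            have hβ : (1 - p) * (p + 1 / (4 * (1 - p))) = p * (1 - p) + 1 / 4 := by field_simp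
            simp only [cycleGame, cycleStep, cycleLyapunov, pow_succ]
            linear_combination (1 / (2 * p)) ^ h * (p + 1 / (4 * (1 - p))) ^ f * (hα + hβ)
        _ ≤ _ := by
            simp only [cycleLyapunov]
            gcongr
            exact le_max_left _ _

lemma min_mul_one_add_le_pow (hγ : 1 < γ) (n : ℕ) : min 1 (γ - 1) * (1 + n) ≤ γ ^ n := by
  calc min 1 (γ - 1) * (1 + n) = min 1 (γ - 1) + n * min 1 (γ - 1) := by ring
    _ ≤ 1 + n * (γ - 1) := by
      gcongr
      exacts [min_le_left _ _, min_le_right _ _]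
    _ ≤ (1 + (γ - 1)) ^ n := one_add_mul_le_pow (by linarith) n
    _ = γ ^ n := by rw [add_sub_cancel]

lemma one_lt_cycleLyapunov_factor (hpq : p + q = 1) (hq : 0 < q) (hqp : q < p) :
    1 < 1 / (2 * p) * (p + 1 / (4 * q)) := by
  have hp : 0 < p := hq.trans hqp
  have heq : 1 / (2 * p) * (p + 1 / (4 * q)) = (4 * (p * q) + 1) / (8 * (p * q)) := by
    field_simp
    ring
  rw [heq, one_lt_div (by positivity)]
  linarith [mul_lt_one_fourth hpq hqp]

lemma exists_one_add_forkLength_le (hpq : p + q = 1) (hq : 0 < q) (hqp : q < p) (A z : ℕ) :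
    ∃ C, 0 ≤ C ∧ ∀ s, ¬ CycleEnds A z s → 1 + (forkLength s : ℝ) ≤ C * cycleLyapunov p q s := by
  have hp : 0 < p := hq.trans hqp
  have hγ := one_lt_cycleLyapunov_factor hpq hq hqp
  set α : ℝ := 1 / (2 * p)
  set β : ℝ := p + 1 / (4 * q)
  have hα0 : 0 < α := by positivity
  have hβ0 : 0 < β := by positivity
  set δ : ℝ := min 1 (α * β - 1)
  have hδ : 0 < δ := lt_min one_pos (by linarith)
  have hα1 : α ≤ 1 := (div_le_one (by positivity)).mpr (by linarith)
  refine ⟨max (1 / (2 * β)) (1 / (δ * α ^ A)), by positivity, ?_⟩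
  rintro (_ | ⟨h, f⟩) hs
  · calc (1 : ℝ) + (0 : ℕ) = 1 / (2 * β) * (2 * β) := by
          field_simp
          simp
      _ ≤ max (1 / (2 * β)) (1 / (δ * α ^ A)) * (2 * β) := by
          gcongr
          exact le_max_left _ _
  · have hpow : α ^ (A + f) ≤ α ^ h := by
      refine pow_le_pow_of_le_one hα0.le hα1 ?_
      simp only [CycleEnds] at hs
      omega
    calc 1 + (f : ℝ) = 1 / (δ * α ^ A) * (α ^ A * (δ * (1 + f))) := by field_simp
      _ ≤ 1 / (δ * α ^ A) * (α ^ A * (α * β) ^ f) := by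
          gcongr
          exact min_mul_one_add_le_pow hγ f
      _ = 1 / (δ * α ^ A) * (α ^ (A + f) * β ^ f) := by
          rw [mul_pow, pow_add]
          ring
      _ ≤ max (1 / (2 * β)) (1 / (δ * α ^ A)) * (α ^ h * β ^ f) := by
          gcongr
          exact le_max_right _ _

end Lyapunov

section Expectations

variable {p q τ₀ D : ℝ} {A z : ℕ} {c : ℝ≥0} {ρ : ℤ → ℤ → ℝ≥0} {V : CycleState → ℝ}

lemma div_div_add_div_div (hpq : p + q = 1) (hτ₀ : 0 < τ₀) (x : ℝ) :
    x / τ₀ / (p / τ₀ + q / τ₀) = x := by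
  rw [← add_div, hpq]
  field_simp

lemma one_div_add_div_div (hpq : p + q = 1) : 1 / (p / τ₀ + q / τ₀) = τ₀ := by
  rw [← add_div, hpq, one_div_one_div]

theorem lintegral_iSup_payoff_cycleGame (hpq : p + q = 1) (hq : 0 < q) (hqp : q < p) (hτ₀ : 0 < τ₀)
    (hV : (cycleGame A z c ρ).IsValue p q τ₀ V)
    (hD : ∀ s, ¬ CycleEnds A z s → |V s| ≤ D * (1 + forkLength s)) (s : CycleState) :
    0 ≤ V s ∧ ∫⁻ w, ⨆ n, (cycleGame A z c ρ).payoff n s w ∂raceLaw (p / τ₀) (q / τ₀) =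
      ENNReal.ofReal (V s) := by
  have hp : 0 < p := hq.trans hqp
  obtain ⟨C, hC, hle⟩ := exists_one_add_forkLength_le hpq hq hqp A z
  have hL := (isLyapunov_cycleLyapunov (A := A) (z := z) (c := c) (ρ := ρ) hpq hq hqp).const_mul
    (mul_nonneg (abs_nonneg D) hC)
  refine Game.lintegral_iSup_payoff (div_pos hp hτ₀) (div_pos hq hτ₀) (V := V)
    (by simpa only [div_div_add_div_div hpq hτ₀, one_div_add_div_div hpq] using hV)
    (by simpa only [div_div_add_div_div hpq hτ₀] using hL) (fun s hs => ?_) s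
  calc |V s| ≤ D * (1 + forkLength s) := hD s hs
    _ ≤ |D| * (C * cycleLyapunov p q s) := by
      gcongr
      exacts [le_abs_self D, hle s hs]
    _ = |D| * C * cycleLyapunov p q s := by ring

lemma ae_endsWithin_cycleGame (hpq : p + q = 1) (hq : 0 < q) (hqp : q < p) (hτ₀ : 0 < τ₀)
    (s : CycleState) :
    ∀ᵐ w ∂raceLaw (p / τ₀) (q / τ₀), ∃ n, (cycleGame A z c ρ).EndsWithin n s w := by
  have hp : 0 < p := hq.trans hqp
  obtain ⟨C, hC, hle⟩ := exists_one_add_forkLength_le hpq hq hqp A z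
  have hL := (isLyapunov_cycleLyapunov (A := A) (z := z) (c := c) (ρ := ρ) hpq hq hqp).const_mul hC
  refine Game.ae_endsWithin (div_pos hp hτ₀) (div_pos hq hτ₀)
    (by simpa only [div_div_add_div_div hpq hτ₀] using hL) (fun s hs => ?_) s
  exact (le_add_of_nonneg_right (Nat.cast_nonneg _)).trans (hle s hs)

variable {Ω : Type*} {X Y : ℕ → Ω → ℝ}

lemma launchTime_eq (ω : Ω) : launchTime Y ω = Y 0 ω := by simp [launchTime, discoveryTime]

lemma confirmations_eq_raceConf (t : ℝ) (ω : Ω) :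
    confirmations X Y t ω = raceConf none (sampleRace X Y ω) t := by
  rw [confirmations, launchTime_eq]
  rfl

lemma secretFork_eq_raceFork (X : ℕ → Ω → ℝ) (t : ℝ) (ω : Ω) :
    secretFork Y t ω = raceFork none (sampleRace X Y ω) t := by
  rw [secretFork, launchTime_eq]
  rfl

lemma endingTimes_eq_raceEnd (ω : Ω) :
    endingTimes A z X Y ω = raceEnd A z none (sampleRace X Y ω) := by
  ext t
  simp only [endingTimes, raceEnd, GivesUpAt, SucceedsAt, lag, launchTime_eq,
    confirmations_eq_raceConf, secretFork_eq_raceFork X]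
  rfl

lemma cycleDuration_eq_raceDuration (ω : Ω) :
    cycleDuration A z X Y ω = raceDuration A z none (sampleRace X Y ω) := by
  rw [cycleDuration, endingTimes_eq_raceEnd, raceDuration]

variable [MeasurableSpace Ω] {μ : Measure Ω}

lemma IsMiningRace.ae_sampleRace (hrace : IsMiningRace μ p q τ₀ X Y) (hpq : p + q = 1) (hq : 0 < q)
    (hqp : q < p) (hτ₀ : 0 < τ₀) (A z : ℕ) (c : ℝ≥0) (ρ : ℤ → ℤ → ℝ≥0) :
    ∀ᵐ ω ∂μ, (∀ k, IsRegular (residual^[k] (sampleRace X Y ω))) ∧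
      ∃ n, (cycleGame A z c ρ).EndsWithin n none (sampleRace X Y ω) := by
  have ha : 0 < p / τ₀ := div_pos (hq.trans hqp) hτ₀
  have hb : 0 < q / τ₀ := div_pos hq hτ₀
  have h := (ae_isRegular_iterate ha hb).and
    (ae_endsWithin_cycleGame (A := A) (z := z) (c := c) (ρ := ρ) hpq hq hqp hτ₀ none)
  rw [← hrace.map_sampleRace ha hb] at h
  exact ae_of_ae_map hrace.aemeasurable_sampleRace h

theorem ae_nonempty_endingTimes (hpq : p + q = 1) (hq : 0 < q) (hqp : q < p) (hτ₀ : 0 < τ₀)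
    (hrace : IsMiningRace μ p q τ₀ X Y) (A z : ℕ) :
    ∀ᵐ ω ∂μ, (endingTimes A z X Y ω).Nonempty := by
  filter_upwards [hrace.ae_sampleRace hpq hq hqp hτ₀ A z 0 0] with ω ⟨hreg, n, hn⟩
  rw [endingTimes_eq_raceEnd]
  exact nonempty_raceEnd hreg hn

/-- The payoff of `cycleGame A z c ρ` when it is played until the end of the attack cycle. -/
noncomputable def cyclePayoff (A z : ℕ) (c : ℝ≥0) (ρ : ℤ → ℤ → ℝ≥0) (X Y : ℕ → Ω → ℝ) (ω : Ω) : ℝ :=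
  c * cycleDuration A z X Y ω + ρ (confirmations X Y (cycleDuration A z X Y ω) ω)
    (secretFork Y (cycleDuration A z X Y ω) ω)

lemma ae_toReal_iSup_payoff_eq (hpq : p + q = 1) (hq : 0 < q) (hqp : q < p) (hτ₀ : 0 < τ₀)
    (hrace : IsMiningRace μ p q τ₀ X Y) :
    ∀ᵐ ω ∂μ, (⨆ n, (cycleGame A z c ρ).payoff n none (sampleRace X Y ω)).toReal =
      cyclePayoff A z c ρ X Y ω := by
  filter_upwards [hrace.ae_sampleRace hpq hq hqp hτ₀ A z c ρ] with ω ⟨hreg, n, hn⟩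
  have hD : 0 ≤ raceDuration A z none (sampleRace X Y ω) := raceDuration_nonneg (hreg 0)
  rw [Game.iSup_payoff_of_endsWithin hn, payoff_cycleGame hreg hn,
    ENNReal.toReal_add (ENNReal.mul_ne_top ENNReal.coe_ne_top ENNReal.ofReal_ne_top)
      ENNReal.coe_ne_top, ENNReal.toReal_mul, ENNReal.toReal_ofReal hD, ENNReal.coe_toReal,
    ENNReal.coe_toReal, cyclePayoff, cycleDuration_eq_raceDuration, confirmations_eq_raceConf,
    secretFork_eq_raceFork X]

theorem integral_cyclePayoff (hpq : p + q = 1) (hq : 0 < q) (hqp : q < p) (hτ₀ : 0 < τ₀)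
    (hrace : IsMiningRace μ p q τ₀ X Y) (hV : (cycleGame A z c ρ).IsValue p q τ₀ V)
    (hD : ∀ s, ¬ CycleEnds A z s → |V s| ≤ D * (1 + forkLength s)) :
    Integrable (cyclePayoff A z c ρ X Y) μ ∧ ∫ ω, cyclePayoff A z c ρ X Y ω ∂μ = V none := by
  set Φ : Race → ℝ≥0∞ := fun w => ⨆ n, (cycleGame A z c ρ).payoff n none w
  have hΦ : Measurable Φ := Measurable.iSup fun n => Game.measurable_payoff n none
  have hΦX : AEMeasurable (fun ω => Φ (sampleRace X Y ω)) μ :=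
    hΦ.comp_aemeasurable hrace.aemeasurable_sampleRace
  obtain ⟨hV0, hint⟩ := lintegral_iSup_payoff_cycleGame hpq hq hqp hτ₀ hV hD none
  have hlint : ∫⁻ ω, Φ (sampleRace X Y ω) ∂μ = ENNReal.ofReal (V none) := by
    rw [← hint, ← hrace.map_sampleRace (div_pos (hq.trans hqp) hτ₀) (div_pos hq hτ₀),
      lintegral_map' hΦ.aemeasurable hrace.aemeasurable_sampleRace]
  have hfin : ∫⁻ ω, Φ (sampleRace X Y ω) ∂μ ≠ ∞ := by simp [hlint]
  have hae := ae_toReal_iSup_payoff_eq (A := A) (z := z) (c := c) (ρ := ρ) hpq hq hqp hτ₀ hrace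
  refine ⟨(integrable_toReal_of_lintegral_ne_top hΦX hfin).congr hae, ?_⟩
  rw [← integral_congr_ae hae, integral_toReal hΦX (ae_lt_top' hΦX hfin), hlint,
    ENNReal.toReal_ofReal hV0]

end Expectations

section Ruin

variable {p q lam : ℝ} {N : ℕ}

/-- The probability that a gambler who plays with the odds `lam` and who lacks `d` points reaches
his goal before he lacks `N` points. -/
noncomputable def ruinProb (lam : ℝ) (N d : ℕ) : ℝ := (lam ^ d - lam ^ N) / (1 - lam ^ N)

/-- The expected number of the points that the gambler wins until he reaches his goal, counted as
`0` if he does not reach it; `p` and `q` are the probabilities to lose and to win a point. The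
formula solves the one-step equations with the boundary values `0` at `d = 0` and `d = N`. -/
noncomputable def ruinGain (p q lam : ℝ) (N d : ℕ) : ℝ :=
  (q * lam ^ N * d + p * d * lam ^ d - N * lam ^ N / (1 - lam ^ N) * (1 - lam ^ d)) /
    ((p - q) * (1 - lam ^ N))

/-- The expected duration of the gambler's game, as the solution of its one-step equations. -/
noncomputable def ruinTime (p q lam : ℝ) (N d : ℕ) : ℝ :=
  (N * ((1 - lam ^ d) / (1 - lam ^ N)) - d) / (p - q)

lemma pow_succ_eq_mean (hpq : p + q = 1) (hlam : lam * p = q) (d : ℕ) :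
    lam ^ (d + 1) = p * lam ^ (d + 2) + q * lam ^ d := by
  linear_combination -lam ^ (d + 1) * hpq + (lam ^ d - lam ^ (d + 1)) * hlam

lemma mul_pow_succ_eq_mean (hpq : p + q = 1) (hlam : lam * p = q) (d : ℕ) :
    (d + 1) * lam ^ (d + 1) =
      (p - q) * lam ^ (d + 1) + (p * ((d + 2) * lam ^ (d + 2)) + q * (d * lam ^ d)) := by
  linear_combination -(d + 1) * lam ^ (d + 1) * hpq +
    (d * lam ^ d - d * lam ^ (d + 1) - 2 * lam ^ (d + 1)) * hlam

lemma ruinProb_zero (hN : lam ^ N ≠ 1) : ruinProb lam N 0 = 1 := by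
  rw [ruinProb, pow_zero, div_self (sub_ne_zero.mpr hN.symm)]

lemma ruinProb_self (lam : ℝ) (N : ℕ) : ruinProb lam N N = 0 := by simp [ruinProb]

lemma ruinProb_succ (hpq : p + q = 1) (hlam : lam * p = q) (N d : ℕ) :
    ruinProb lam N (d + 1) = p * ruinProb lam N (d + 2) + q * ruinProb lam N d := by
  simp only [ruinProb]
  linear_combination (pow_succ_eq_mean hpq hlam d + lam ^ N * hpq) / (1 - lam ^ N)

lemma ruinGain_zero (p q lam : ℝ) (N : ℕ) : ruinGain p q lam N 0 = 0 := by simp [ruinGain]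

lemma ruinGain_self (hpq : p + q = 1) (hN : lam ^ N ≠ 1) : ruinGain p q lam N N = 0 := by
  rw [ruinGain, div_mul_cancel₀ _ (sub_ne_zero.mpr hN.symm), div_eq_zero_iff]
  left
  linear_combination N * lam ^ N * hpq

lemma ruinGain_succ (hpq : p + q = 1) (hne : p ≠ q) (hlam : lam * p = q) (N d : ℕ) :
    ruinGain p q lam N (d + 1) = p * ruinGain p q lam N (d + 2) +
      q * (ruinGain p q lam N d + ruinProb lam N d) := by
  have hinv : (p - q) * (p - q)⁻¹ = 1 := mul_inv_cancel₀ (sub_ne_zero.mpr hne)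
  simp only [ruinGain, ruinProb, ← div_div]
  push_cast
  linear_combination (N * lam ^ N / (1 - lam ^ N) * (pow_succ_eq_mean hpq hlam d + hpq) +
    p * mul_pow_succ_eq_mean hpq hlam d - q * lam ^ N * (d + 1) * hpq +
    (p - q) * lam ^ d * hlam) / (p - q) / (1 - lam ^ N) +
    q * (lam ^ d - lam ^ N) / (1 - lam ^ N) * hinv

lemma ruinTime_zero (p q lam : ℝ) (N : ℕ) : ruinTime p q lam N 0 = 0 := by simp [ruinTime]

lemma ruinTime_self (p q : ℝ) (hN : lam ^ N ≠ 1) : ruinTime p q lam N N = 0 := by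
  rw [ruinTime, div_self (sub_ne_zero.mpr hN.symm), mul_one, sub_self, zero_div]

lemma ruinTime_succ (hpq : p + q = 1) (hne : p ≠ q) (hlam : lam * p = q) (N d : ℕ) :
    ruinTime p q lam N (d + 1) =
      1 + (p * ruinTime p q lam N (d + 2) + q * ruinTime p q lam N d) := by
  have hinv : (p - q) * (p - q)⁻¹ = 1 := mul_inv_cancel₀ (sub_ne_zero.mpr hne)
  simp only [ruinTime]
  push_cast
  linear_combination (-N / (1 - lam ^ N) * (pow_succ_eq_mean hpq hlam d + hpq) +
    (d + 1) * hpq) / (p - q) + hinv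

end Ruin

section ConfirmationMean

variable {p q : ℝ} {z : ℕ} {χ : ℕ → ℝ}

/-- The expectation of `χ (f + K)` restricted to `f + K ≤ z`, where `K` is the number of blocks that
the attacker mines before the `n`-th block of the honest miners. -/
noncomputable def confirmMean (p q : ℝ) (z : ℕ) (χ : ℕ → ℝ) (n f : ℕ) : ℝ :=
  ∑ k ∈ Finset.range (z + 1 - f), (n.multichoose k : ℝ) * p ^ n * q ^ k * χ (f + k)

lemma confirmMean_of_lt {n f : ℕ} (hf : z < f) : confirmMean p q z χ n f = 0 := by
  rw [confirmMean, Nat.sub_eq_zero_of_le hf, Finset.sum_range_zero]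

lemma confirmMean_zero {f : ℕ} (hf : f ≤ z) : confirmMean p q z χ 0 f = χ f := by
  rw [confirmMean, Nat.succ_sub hf, Finset.sum_range_succ']
  simp

lemma confirmMean_succ (n f : ℕ) :
    confirmMean p q z χ (n + 1) f =
      p * confirmMean p q z χ n f + q * confirmMean p q z χ (n + 1) (f + 1) := by
  rcases lt_or_ge z f with hf | hf
  · simp only [confirmMean_of_lt hf, confirmMean_of_lt (hf.trans f.lt_succ_self), mul_zero,
      add_zero]
  · have hz : z + 1 - f = (z - f) + 1 := by omega
    have hz' : z + 1 - (f + 1) = z - f := by omega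
    simp only [confirmMean]
    rw [hz, hz', Finset.sum_range_succ', Finset.sum_range_succ' _ (z - f), mul_add, Finset.mul_sum,
      Finset.mul_sum, add_right_comm, ← Finset.sum_add_distrib]
    congr 1
    · refine Finset.sum_congr rfl fun k _ => ?_
      rw [Nat.multichoose_succ_succ, show f + 1 + k = f + (k + 1) by omega]
      push_cast
      ring
    · simp only [Nat.multichoose_zero_right]
      ring

lemma exists_abs_confirmMean_le (p q : ℝ) (z : ℕ) (χ : ℕ → ℝ) :
    ∃ C, 0 ≤ C ∧ ∀ n ≤ z, ∀ f, |confirmMean p q z χ n f| ≤ C := by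
  obtain ⟨C, hC⟩ := ((Finset.range (z + 1) ×ˢ Finset.range (z + 1)).image
    fun i => |confirmMean p q z χ i.1 i.2|).exists_le
  refine ⟨max C 0, le_max_right _ _, fun n hn f => ?_⟩
  rcases lt_or_ge z f with hf | hf
  · rw [confirmMean_of_lt hf, abs_zero]
    exact le_max_right _ _
  · exact le_max_of_le_left (hC _ (Finset.mem_image.mpr ⟨(n, f), by simp; omega, rfl⟩))

end ConfirmationMean

section Value

variable {p q lam e α β : ℝ} {A z N : ℕ}

/-- The value of a state after the last confirmation, for the reward `α + β * f` of a success with a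
secret fork of length `f` and the expected cost `e` of a block: the secret fork of length `f` lacks
`d` blocks for a success, and the attacker gives up when it lacks `N` blocks. -/
noncomputable def chaseValue (p q lam e α β : ℝ) (N f d : ℕ) : ℝ :=
  (α + β * f) * ruinProb lam N d + β * ruinGain p q lam N d + e * ruinTime p q lam N d

/-- The value of a state before the `z`-th confirmation if the success were sure. -/
noncomputable def sureValue (p q e α β : ℝ) (z h f : ℕ) : ℝ :=
  α + β * f + (z - h) * ((e + q * β) / p)

/-- The value of the states of an attack cycle before the `z`-th confirmation. -/
noncomputable def waitValue (p q lam e α β : ℝ) (A z h f : ℕ) : ℝ :=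
  sureValue p q e α β z h f + confirmMean p q z
    (fun f => chaseValue p q lam e α β (A + 1) f (z + 1 - f) - sureValue p q e α β z z f) (z - h) f

/-- The value of the states of an attack cycle. The truncated difference `h + 1 - f` vanishes if the
secret fork is longer than the official blockchain. -/
noncomputable def cycleValue (p q lam e α β : ℝ) (A z : ℕ) : CycleState → ℝ
  | none => e / q + waitValue p q lam e α β A z 0 1
  | some (h, f) =>
    if h < z then waitValue p q lam e α β A z h f
    else chaseValue p q lam e α β (A + 1) f (min (h + 1 - f) (A + 1))

lemma chaseValue_zero (p q e α β : ℝ) (f : ℕ) (hN : lam ^ N ≠ 1) :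
    chaseValue p q lam e α β N f 0 = α + β * f := by
  simp only [chaseValue, ruinProb_zero hN, ruinGain_zero, ruinTime_zero, mul_one, mul_zero,
    add_zero]

lemma chaseValue_self (e α β : ℝ) (f : ℕ) (hpq : p + q = 1) (hN : lam ^ N ≠ 1) :
    chaseValue p q lam e α β N f N = 0 := by
  simp only [chaseValue, ruinProb_self, ruinGain_self hpq hN, ruinTime_self p q hN, mul_zero,
    add_zero]

lemma chaseValue_succ (hpq : p + q = 1) (hne : p ≠ q) (hlam : lam * p = q) (e α β : ℝ)
    (N f d : ℕ) : chaseValue p q lam e α β N f (d + 1) = e +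
      (p * chaseValue p q lam e α β N f (d + 2) + q * chaseValue p q lam e α β N (f + 1) d) := by
  simp only [chaseValue, ruinProb_succ hpq hlam N d, ruinGain_succ hpq hne hlam N d,
    ruinTime_succ hpq hne hlam N d]
  push_cast
  ring

lemma sureValue_self (p q e α β : ℝ) (z f : ℕ) : sureValue p q e α β z z f = α + β * f := by
  rw [sureValue, sub_self, zero_mul, add_zero]

lemma sureValue_eq (hpq : p + q = 1) (hp : p ≠ 0) (e α β : ℝ) (z h f : ℕ) :
    sureValue p q e α β z h f = e +
      (p * sureValue p q e α β z (h + 1) f + q * sureValue p q e α β z h (f + 1)) := by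
  have hmul : p * ((e + q * β) / p) = e + q * β := mul_div_cancel₀ _ hp
  simp only [sureValue]
  push_cast
  linear_combination hmul - (α + β * f + (z - h) * ((e + q * β) / p)) * hpq

lemma waitValue_self (hz : z ≤ A) (hN : lam ^ (A + 1) ≠ 1) (f : ℕ) :
    waitValue p q lam e α β A z z f =
      chaseValue p q lam e α β (A + 1) f (min (z + 1 - f) (A + 1)) := by
  rw [waitValue, Nat.sub_self, min_eq_left (by omega)]
  rcases lt_or_ge z f with hf | hf
  · rw [confirmMean_of_lt hf, add_zero, Nat.sub_eq_zero_of_le hf, chaseValue_zero p q e α β f hN,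
      sureValue_self]
  · rw [confirmMean_zero hf, add_sub_cancel]

lemma waitValue_eq (hpq : p + q = 1) (hp : p ≠ 0) {h : ℕ} (hh : h < z) (f : ℕ) :
    waitValue p q lam e α β A z h f = e + (p * waitValue p q lam e α β A z (h + 1) f +
      q * waitValue p q lam e α β A z h (f + 1)) := by
  obtain ⟨n, hn⟩ : ∃ n, z - h = n + 1 := ⟨z - (h + 1), by omega⟩
  have hn' : z - (h + 1) = n := by omega
  rw [waitValue, waitValue, waitValue, hn, hn', confirmMean_succ, sureValue_eq hpq hp]
  ring

lemma cycleValue_of_le (hz : z ≤ A) (hN : lam ^ (A + 1) ≠ 1) {h : ℕ} (hh : h ≤ z) (f : ℕ) :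
    cycleValue p q lam e α β A z (some (h, f)) = waitValue p q lam e α β A z h f := by
  rcases hh.lt_or_eq with hh | rfl
  · rw [cycleValue, if_pos hh]
  · rw [cycleValue, if_neg (lt_irrefl _), waitValue_self hz hN]

lemma cycleValue_of_not_lt {h d f : ℕ} (hh : ¬ h < z) (hd : min (h + 1 - f) (A + 1) = d) :
    cycleValue p q lam e α β A z (some (h, f)) = chaseValue p q lam e α β (A + 1) f d := by
  rw [cycleValue, if_neg hh, hd]

lemma cycleValue_of_not_ends (hpq : p + q = 1) (hne : p ≠ q) (hp : p ≠ 0) (hq : q ≠ 0)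
    (hlam : lam * p = q) (hz : z ≤ A) (hN : lam ^ (A + 1) ≠ 1) {s : CycleState}
    (hs : ¬ CycleEnds A z s) :
    cycleValue p q lam e α β A z s = e + (p * cycleValue p q lam e α β A z (cycleStep s true) +
      q * cycleValue p q lam e α β A z (cycleStep s false)) := by
  rcases s with _ | ⟨h, f⟩
  · have heq : q * (e / q) = e := mul_div_cancel₀ _ hq
    simp only [cycleStep, cycleValue_of_le hz hN z.zero_le]
    simp only [cycleValue]
    linear_combination heq - (e / q + waitValue p q lam e α β A z 0 1) * hpq
  · simp only [cycleStep]
    rcases lt_or_ge h z with hh | hh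
    · rw [cycleValue_of_le hz hN hh.le, cycleValue_of_le hz hN hh.le, cycleValue_of_le hz hN hh]
      exact waitValue_eq hpq hp hh f
    · obtain ⟨d, rfl, hd⟩ : ∃ d, h = f + d ∧ d < A := by
        simp only [CycleEnds, not_or, not_and, not_le, not_lt] at hs
        exact ⟨h - f, by omega, by omega⟩
      rw [cycleValue_of_not_lt (d := d + 1) (by omega) (by omega),
        cycleValue_of_not_lt (d := d + 2) (by omega) (by omega),
        cycleValue_of_not_lt (d := d) (by omega) (by omega)]
      exact chaseValue_succ hpq hne hlam e α β (A + 1) f d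

lemma cycleValue_of_ends (hpq : p + q = 1) (hz : z ≤ A) (hN : lam ^ (A + 1) ≠ 1) {h f : ℕ}
    (hs : CycleEnds A z (some (h, f))) : cycleValue p q lam e α β A z (some (h, f)) =
      if (z : ℤ) ≤ h ∧ (h : ℤ) - f < 0 then α + β * f else 0 := by
  simp only [CycleEnds] at hs
  split_ifs with hsucc
  · rw [cycleValue_of_not_lt (d := 0) (by omega) (by omega), chaseValue_zero p q e α β f hN]
  · rw [cycleValue_of_not_lt (d := A + 1) (by omega) (by omega), chaseValue_self e α β f hpq hN]

lemma exists_abs_chaseValue_le (p q lam e α β : ℝ) (N : ℕ) :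
    ∃ C, ∀ d ≤ N, ∀ f : ℕ, |chaseValue p q lam e α β N f d| ≤ C * (1 + f) := by
  obtain ⟨C, hC⟩ := ((Finset.range (N + 1)).image fun d =>
    max |α * ruinProb lam N d + β * ruinGain p q lam N d + e * ruinTime p q lam N d|
      |β * ruinProb lam N d|).exists_le
  refine ⟨C, fun d hd f => ?_⟩
  have hmax := hC _ (Finset.mem_image_of_mem _ (Finset.mem_range.mpr (Nat.lt_succ_of_le hd)))
  calc |chaseValue p q lam e α β N f d|
      = |(α * ruinProb lam N d + β * ruinGain p q lam N d + e * ruinTime p q lam N d) +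
          β * ruinProb lam N d * f| := by
        rw [chaseValue]
        congr 1
        ring
    _ ≤ |α * ruinProb lam N d + β * ruinGain p q lam N d + e * ruinTime p q lam N d| +
          |β * ruinProb lam N d| * f := by
        refine (abs_add_le _ _).trans_eq ?_
        rw [abs_mul _ (f : ℝ), Nat.abs_cast]
    _ ≤ C + C * f := by
        gcongr
        exacts [(le_max_left _ _).trans hmax, (le_max_right _ _).trans hmax]
    _ = C * (1 + f) := by ring

lemma exists_abs_waitValue_le (p q lam e α β : ℝ) (A z : ℕ) :
    ∃ C, ∀ h ≤ z, ∀ f : ℕ, |waitValue p q lam e α β A z h f| ≤ C * (1 + f) := by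
  obtain ⟨M, hM, hle⟩ := exists_abs_confirmMean_le p q z fun f =>
    chaseValue p q lam e α β (A + 1) f (z + 1 - f) - sureValue p q e α β z z f
  set δ : ℝ := (e + q * β) / p
  refine ⟨|α| + |β| + z * |δ| + M, fun h hh f => ?_⟩
  have hzh : |(z : ℝ) - h| ≤ z := by
    rw [abs_of_nonneg (sub_nonneg.mpr (by exact_mod_cast hh))]
    exact sub_le_self _ h.cast_nonneg
  calc |waitValue p q lam e α β A z h f|
      ≤ |α| + |β| * f + |(z : ℝ) - h| * |δ| + M := by
        refine (abs_add_le _ _).trans (add_le_add ?_ (hle _ (Nat.sub_le z h) f))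
        rw [sureValue, ← abs_mul, ← Nat.abs_cast f, ← abs_mul, Nat.abs_cast]
        exact (abs_add_le _ _).trans (by gcongr; exact abs_add_le _ _)
    _ ≤ |α| + |β| * f + z * |δ| + M := by gcongr
    _ ≤ |α| + |β| * f + z * |δ| + M + (|β| + (|α| + z * |δ| + M) * f) :=
        le_add_of_nonneg_right (by positivity)
    _ = (|α| + |β| + z * |δ| + M) * (1 + f) := by ring

lemma exists_abs_cycleValue_le (p q lam e α β : ℝ) (A z : ℕ) :
    ∃ C, ∀ s, |cycleValue p q lam e α β A z s| ≤ C * (1 + forkLength s) := by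
  obtain ⟨C₁, hC₁⟩ := exists_abs_waitValue_le p q lam e α β A z
  obtain ⟨C₂, hC₂⟩ := exists_abs_chaseValue_le p q lam e α β (A + 1)
  refine ⟨max |cycleValue p q lam e α β A z none| (max C₁ C₂), ?_⟩
  rintro (_ | ⟨h, f⟩)
  · simp [forkLength]
  · simp only [cycleValue, forkLength]
    split_ifs with hh
    · refine (hC₁ h hh.le f).trans ?_
      gcongr
      exact le_max_of_le_right (le_max_left _ _)
    · refine (hC₂ _ (min_le_right _ _) f).trans ?_
      gcongr
      exact le_max_of_le_right (le_max_right _ _)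

end Value

section CycleIntegral

variable {p q lam τ₀ : ℝ} {A z : ℕ}

lemma lt_one_of_mul_eq (hq : 0 < q) (hqp : q < p) (hlam : lam * p = q) : lam < 1 := by
  have hp : 0 < p := hq.trans hqp
  rwa [← hlam, mul_lt_iff_lt_one_left hp] at hqp

lemma pow_succ_lt_one_of_mul_eq (hq : 0 < q) (hqp : q < p) (hlam : lam * p = q) (n : ℕ) :
    lam ^ (n + 1) < 1 :=
  pow_lt_one₀ (pos_of_mul_pos_left (hlam ▸ hq) (hq.trans hqp).le).le
    (lt_one_of_mul_eq hq hqp hlam) n.succ_ne_zero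

/-- The reward `α + β * f` of a success with `h` confirmations and a secret fork of length `f`. -/
noncomputable def successReward (z : ℕ) (α β : ℝ≥0) (h f : ℤ) : ℝ≥0 :=
  if (z : ℤ) ≤ h ∧ h - f < 0 then α + β * f.toNat else 0

lemma isValue_cycleValue (hpq : p + q = 1) (hq : 0 < q) (hqp : q < p) (hlam : lam * p = q)
    (hz : z ≤ A) (c α β : ℝ≥0) (τ₀ : ℝ) :
    (cycleGame A z c (successReward z α β)).IsValue p q τ₀
      (cycleValue p q lam (c * τ₀) α β A z) where
  of_stopped s hs := by
    rcases s with _ | ⟨h, f⟩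
    · exact hs.elim
    · rw [cycleValue_of_ends hpq hz (pow_succ_lt_one_of_mul_eq hq hqp hlam A).ne hs]
      simp only [cycleGame, successReward]
      split_ifs <;> simp
  of_not_stopped _ hs := cycleValue_of_not_ends hpq hqp.ne' (hq.trans hqp).ne' hq.ne' hlam hz
    (pow_succ_lt_one_of_mul_eq hq hqp hlam A).ne hs

variable {Ω : Type*} {X Y : ℕ → Ω → ℝ}

open Classical in
lemma cyclePayoff_successReward (c α β : ℝ≥0) (ω : Ω) :
    cyclePayoff A z c (successReward z α β) X Y ω =
      c * cycleDuration A z X Y ω +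
        if IsSuccess A z X Y ω then α + β * (secretFork Y (cycleDuration A z X Y ω) ω : ℝ)
        else 0 := by
  rw [cyclePayoff, successReward]
  congr 1
  by_cases hs : IsSuccess A z X Y ω
  · have hlag : (z : ℤ) ≤ confirmations X Y (cycleDuration A z X Y ω) ω ∧
        confirmations X Y (cycleDuration A z X Y ω) ω -
          secretFork Y (cycleDuration A z X Y ω) ω < 0 := hs
    have hcast : ((secretFork Y (cycleDuration A z X Y ω) ω).toNat : ℤ) =
        secretFork Y (cycleDuration A z X Y ω) ω := Int.toNat_of_nonneg (by omega)
    rw [if_pos hs, if_pos hlag]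
    conv_rhs => rw [← hcast]
    simp only [NNReal.coe_add, NNReal.coe_mul, NNReal.coe_natCast, Int.cast_natCast]
  · rw [if_neg hs]
    exact NNReal.coe_eq_zero.mpr (if_neg hs)

open Classical in
theorem integral_cycle [MeasurableSpace Ω] {μ : Measure Ω} (hpq : p + q = 1) (hq : 0 < q)
    (hqp : q < p) (hlam : lam * p = q) (hτ₀ : 0 < τ₀) (hz : z ≤ A)
    (hrace : IsMiningRace μ p q τ₀ X Y) (c α β : ℝ≥0) :
    Integrable (fun ω => c * cycleDuration A z X Y ω + if IsSuccess A z X Y ω then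
        α + β * (secretFork Y (cycleDuration A z X Y ω) ω : ℝ) else 0) μ ∧
      ∫ ω, (c * cycleDuration A z X Y ω + if IsSuccess A z X Y ω then
        α + β * (secretFork Y (cycleDuration A z X Y ω) ω : ℝ) else 0) ∂μ =
      cycleValue p q lam (c * τ₀) α β A z none := by
  obtain ⟨C, hC⟩ := exists_abs_cycleValue_le p q lam (c * τ₀) α β A z
  simp only [← cyclePayoff_successReward]
  exact integral_cyclePayoff hpq hq hqp hτ₀ hrace
    (isValue_cycleValue hpq hq hqp hlam hz c α β τ₀) fun s _ => hC s

end CycleIntegral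

section IncompleteBeta

variable {a b s x : ℝ}

lemma regIncBeta_eq (x a b : ℝ) :
    regIncBeta x a b = 1 / beta a b * ∫ t in (0 : ℝ)..x, t ^ (a - 1) * (1 - t) ^ (b - 1) := by
  rw [regIncBeta, beta, one_div_div]

lemma betaIntegrand_eq_ofReal (a b : ℝ) {t : ℝ} (ht : t ∈ Set.uIcc 0 1) :
    (t : ℂ) ^ ((a : ℂ) - 1) * (1 - (t : ℂ)) ^ ((b : ℂ) - 1) =
      ((t ^ (a - 1) * (1 - t) ^ (b - 1) : ℝ) : ℂ) := by
  rw [Set.uIcc_of_le zero_le_one] at ht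
  push_cast [Complex.ofReal_cpow ht.1, Complex.ofReal_cpow (sub_nonneg.mpr ht.2)]
  rfl

lemma intervalIntegrable_betaIntegrand (ha : 0 < a) (hb : 0 < b) :
    IntervalIntegrable (fun t : ℝ => t ^ (a - 1) * (1 - t) ^ (b - 1)) volume 0 1 := by
  have h := Complex.betaIntegral_convergent (u := a) (v := b) (by simpa) (by simpa)
  rw [intervalIntegrable_iff] at h ⊢
  refine IntegrableOn.congr_fun h.re (fun t ht => ?_) measurableSet_uIoc
  rw [betaIntegrand_eq_ofReal a b (Set.uIoc_subset_uIcc ht), RCLike.re_to_complex,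
    Complex.ofReal_re]

lemma integral_betaIntegrand (ha : 0 < a) (hb : 0 < b) :
    ∫ t in (0 : ℝ)..1, t ^ (a - 1) * (1 - t) ^ (b - 1) = beta a b := by
  rw [beta_eq_betaIntegralReal a b ha hb, Complex.betaIntegral,
    intervalIntegral.integral_congr fun t ht => betaIntegrand_eq_ofReal a b ht,
    intervalIntegral.integral_ofReal, Complex.ofReal_re]

theorem regIncBeta_add_regIncBeta (ha : 0 < a) (hb : 0 < b) (hx0 : 0 ≤ x) (hx1 : x ≤ 1) :
    regIncBeta x a b + regIncBeta (1 - x) b a = 1 := by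
  have hsymm : beta b a = beta a b := by rw [beta, beta, add_comm, mul_comm (Real.Gamma b)]
  have hI := intervalIntegrable_betaIntegrand ha hb
  have hrefl : ∫ t in (0 : ℝ)..(1 - x), t ^ (b - 1) * (1 - t) ^ (a - 1) =
      ∫ t in x..1, t ^ (a - 1) * (1 - t) ^ (b - 1) := by
    have h := intervalIntegral.integral_comp_sub_left
      (fun t : ℝ => t ^ (a - 1) * (1 - t) ^ (b - 1)) (1 : ℝ) (a := 0) (b := 1 - x)
    simp only [sub_sub_cancel, sub_zero] at h
    rw [← h]
    exact intervalIntegral.integral_congr fun t _ => mul_comm _ _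
  have hx : x ∈ Set.uIcc 0 1 := Set.mem_uIcc_of_le hx0 hx1
  rw [regIncBeta_eq, regIncBeta_eq, hsymm, hrefl, ← mul_add,
    intervalIntegral.integral_add_adjacent_intervals
      (hI.mono_set (Set.uIcc_subset_uIcc_left hx)) (hI.mono_set (Set.uIcc_subset_uIcc_right hx)),
    integral_betaIntegrand ha hb, one_div_mul_cancel (beta_pos ha hb).ne']

lemma one_div_beta_half (hs : 0 < s) : 1 / beta s (1 / 2) * 4 ^ s = 2 * (1 / beta s s) := by
  have hdup := Real.Gamma_mul_Gamma_add_half s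
  have hΓs := Real.Gamma_pos_of_pos hs
  have hΓh : 0 < Real.Gamma (s + 1 / 2) := Real.Gamma_pos_of_pos (by positivity)
  have hΓd : 0 < Real.Gamma (2 * s) := Real.Gamma_pos_of_pos (by positivity)
  have hπ : 0 < √Real.pi := Real.sqrt_pos.mpr Real.pi_pos
  have hpow : (2 : ℝ) ^ (1 - 2 * s) = 2 / 4 ^ s := by
    rw [Real.rpow_sub two_pos, Real.rpow_one, Real.rpow_mul zero_le_two, Real.rpow_two]
    norm_num
  rw [hpow] at hdup
  rw [beta, beta, Real.Gamma_one_half_eq, ← two_mul]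
  field_simp at hdup ⊢
  linarith

lemma betaIntegrand_comp_mul_deriv (s : ℝ) {u : ℝ} (hu0 : 0 ≤ u) (hu : u < 1 / 2) :
    (4 * (1 - u) * u) ^ (s - 1) * (1 - 4 * (1 - u) * u) ^ ((1 / 2 : ℝ) - 1) * (4 * (1 - 2 * u)) =
      4 ^ s * (u ^ (s - 1) * (1 - u) ^ (s - 1)) := by
  have hu1 : 0 < 1 - 2 * u := by linarith
  have hsqrt : (1 - 4 * (1 - u) * u) ^ ((1 / 2 : ℝ) - 1) = (1 - 2 * u)⁻¹ := by
    rw [show 1 - 4 * (1 - u) * u = (1 - 2 * u) ^ (2 : ℝ) by rw [Real.rpow_two]; ring,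
      ← Real.rpow_mul hu1.le, ← Real.rpow_neg_one]
    norm_num
  have hpow : (4 : ℝ) ^ s = 4 ^ (s - 1) * 4 := by
    rw [← Real.rpow_add_one four_ne_zero, sub_add_cancel]
  have hjac : (1 - 2 * u)⁻¹ * (4 * (1 - 2 * u)) = 4 := by
    rw [mul_left_comm, inv_mul_cancel₀ hu1.ne', mul_one]
  rw [hsqrt, Real.mul_rpow (by linarith) hu0, Real.mul_rpow zero_le_four (by linarith), mul_assoc,
    hjac, hpow]
  ring

lemma integral_betaIntegrand_half (s : ℝ) (hx0 : 0 ≤ x) (hx : x < 1 / 2) :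
    ∫ t in (0 : ℝ)..4 * (1 - x) * x, t ^ (s - 1) * (1 - t) ^ ((1 / 2 : ℝ) - 1) =
      4 ^ s * ∫ u in (0 : ℝ)..x, u ^ (s - 1) * (1 - u) ^ (s - 1) := by
  have hderiv (u : ℝ) : HasDerivAt (fun u : ℝ => 4 * (1 - u) * u) (4 * (1 - 2 * u)) u := by
    refine ((((hasDerivAt_id u).const_sub 1).const_mul 4).mul (hasDerivAt_id u)).congr_deriv ?_
    simp only [id]
    ring
  have hsub := intervalIntegral.integral_comp_mul_deriv_of_deriv_nonneg (a := 0) (b := x)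
    (f := fun u : ℝ => 4 * (1 - u) * u) (f' := fun u => 4 * (1 - 2 * u))
    (g := fun t : ℝ => t ^ (s - 1) * (1 - t) ^ ((1 / 2 : ℝ) - 1))
    (by fun_prop) (fun u _ => hderiv u) fun u hu => by
      rw [max_eq_right hx0] at hu
      linarith [hu.2]
  rw [mul_zero] at hsub
  rw [← hsub, ← intervalIntegral.integral_const_mul]
  refine intervalIntegral.integral_congr fun u hu => ?_
  rw [Set.uIcc_of_le hx0] at hu
  exact betaIntegrand_comp_mul_deriv s hu.1 (hu.2.trans_lt hx)

theorem regIncBeta_four_mul (hs : 0 < s) (hx0 : 0 ≤ x) (hx : x < 1 / 2) :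
    regIncBeta (4 * (1 - x) * x) s (1 / 2) = 2 * regIncBeta x s s := by
  rw [regIncBeta_eq, regIncBeta_eq, integral_betaIntegrand_half s hx0 hx, ← mul_assoc,
    one_div_beta_half hs, mul_assoc]

end IncompleteBeta

section NegativeBinomial

variable {z n : ℕ} {x y p q : ℝ}

/-- The distribution function of a negative binomial law: `x` is the probability of a success of
which `z` are awaited, `y` the probability of a failure, and there are fewer than `n` failures. -/
noncomputable def negBinSum (z n : ℕ) (x y : ℝ) : ℝ :=
  ∑ k ∈ Finset.range n, (z.multichoose k : ℝ) * x ^ z * y ^ k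

lemma negBinSum_succ (z n : ℕ) (x y : ℝ) :
    negBinSum z (n + 1) x y = negBinSum z n x y + z.multichoose n * x ^ z * y ^ n :=
  Finset.sum_range_succ _ _

lemma succ_mul_multichoose_succ (z k : ℕ) :
    ((k + 1 : ℕ) : ℝ) * z.multichoose (k + 1) = (z + k) * z.multichoose k := by
  norm_cast
  rcases z with _ | m
  · rcases k with _ | k <;> simp [Nat.multichoose_zero_succ]
  · rw [Nat.multichoose_eq, Nat.multichoose_eq, mul_comm,
      show m + 1 + (k + 1) - 1 = m + k + 1 by omega,
      show m + 1 + k - 1 = m + k by omega, ← Nat.add_one_mul_choose_eq, add_right_comm]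

lemma hasDerivAt_negBinSum (hz : z ≠ 0) (n : ℕ) (x : ℝ) :
    HasDerivAt (fun x => negBinSum z n x (1 - x))
      (n * z.multichoose n * x ^ (z - 1) * (1 - x) ^ (n - 1)) x := by
  induction n with
  | zero => simpa [negBinSum] using hasDerivAt_const x (0 : ℝ)
  | succ n ih =>
    have hy : HasDerivAt (fun x : ℝ => 1 - x) (-1) x := by
      simpa using (hasDerivAt_id x).const_sub 1
    simp only [negBinSum_succ]
    refine (ih.add (((hasDerivAt_pow z x).const_mul (z.multichoose n : ℝ)).mul (hy.pow n)))
      |>.congr_deriv ?_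
    rw [succ_mul_multichoose_succ]
    obtain ⟨m, rfl⟩ := Nat.exists_eq_succ_of_ne_zero hz
    rcases n with _ | n
    all_goals
      simp only [Nat.add_sub_cancel, Nat.succ_eq_add_one, Pi.pow_apply]
      push_cast
      ring

lemma one_div_beta_natCast (hz : z ≠ 0) (hn : n ≠ 0) :
    1 / beta (z : ℝ) n = n * z.multichoose n := by
  obtain ⟨k, rfl⟩ := Nat.exists_eq_succ_of_ne_zero hz
  obtain ⟨m, rfl⟩ := Nat.exists_eq_succ_of_ne_zero hn
  have hchoose := Nat.choose_mul_factorial_mul_factorial (show m + 1 ≤ k + m + 1 by omega)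
  rw [show k + m + 1 - (m + 1) = k by omega, Nat.factorial_succ m] at hchoose
  have hsum : ((k + 1 : ℕ) : ℝ) + (m + 1 : ℕ) = ((k + m + 1 : ℕ) : ℝ) + 1 := by
    push_cast
    ring
  rw [beta, hsum, Real.Gamma_nat_eq_factorial, Nat.cast_succ, Nat.cast_succ,
    Real.Gamma_nat_eq_factorial, Real.Gamma_nat_eq_factorial, ← hchoose, Nat.multichoose_eq,
    show k + 1 + (m + 1) - 1 = k + m + 1 by omega]
  push_cast
  field_simp [k.factorial_ne_zero, m.factorial_ne_zero]

theorem regIncBeta_natCast (hz : z ≠ 0) (hn : n ≠ 0) (x : ℝ) :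
    regIncBeta x z n = negBinSum z n x (1 - x) := by
  have hpow (m : ℕ) (hm : m ≠ 0) (t : ℝ) : t ^ ((m : ℝ) - 1) = t ^ (m - 1) := by
    rw [← Nat.cast_pred (Nat.pos_of_ne_zero hm), Real.rpow_natCast]
  have hint := intervalIntegral.integral_eq_sub_of_hasDerivAt (a := 0) (b := x)
    (f := fun t => negBinSum z n t (1 - t))
    (f' := fun t => n * z.multichoose n * t ^ (z - 1) * (1 - t) ^ (n - 1))
    (fun t _ => hasDerivAt_negBinSum hz n t) (Continuous.intervalIntegrable (by fun_prop) _ _)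
  have hzero : negBinSum z n 0 (1 - 0) = 0 := by simp [negBinSum, hz]
  rw [hzero, sub_zero] at hint
  rw [regIncBeta_eq, one_div_beta_natCast hz hn, ← intervalIntegral.integral_const_mul, ← hint]
  refine intervalIntegral.integral_congr fun t _ => ?_
  simp only [hpow z hz, hpow n hn]
  ring

theorem negBinSum_add_negBinSum (hpq : p + q = 1) (hp : 0 ≤ p) (hq : 0 ≤ q) (hz : z ≠ 0)
    (hn : n ≠ 0) : negBinSum z n p q + negBinSum n z q p = 1 := by
  obtain rfl : q = 1 - p := by linarith
  have h := regIncBeta_add_regIncBeta (a := z) (b := n) (by positivity) (by positivity) hp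
    (by linarith)
  rwa [regIncBeta_natCast hz hn, regIncBeta_natCast hn hz, sub_sub_cancel] at h

lemma mul_sum_mul_negBin (hxy : x + y = 1) (z n : ℕ) :
    x * ∑ k ∈ Finset.range n, (k : ℝ) * (z.multichoose k * x ^ z * y ^ k) =
      y * z * negBinSum z n x y - n * z.multichoose n * x ^ z * y ^ n := by
  induction n with
  | zero => simp [negBinSum]
  | succ n ih =>
    rw [Finset.sum_range_succ, mul_add, ih, negBinSum_succ, succ_mul_multichoose_succ]
    linear_combination n * z.multichoose n * x ^ z * y ^ n * hxy

lemma regIncBeta_half_eq (hpq : p + q = 1) (hq : 0 < q) (hqp : q < p) (hz : z ≠ 0) :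
    regIncBeta (4 * p * q) z (1 / 2) = 2 * negBinSum z z q p := by
  obtain rfl : p = 1 - q := by linarith
  rw [regIncBeta_four_mul (by positivity) hq.le (by linarith), regIncBeta_natCast hz hz]

lemma regIncBeta_half_left_eq (hpq : p + q = 1) (hq : 0 < q) (hqp : q < p) (hz : z ≠ 0) :
    regIncBeta ((p - q) ^ 2) (1 / 2) z = 1 - 2 * negBinSum z z q p := by
  have hp : 0 < p := hq.trans hqp
  have h := regIncBeta_add_regIncBeta (a := z) (b := 1 / 2) (x := 4 * p * q) (by positivity)
    one_half_pos (by positivity) (by nlinarith [mul_lt_one_fourth hpq hqp])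
  rw [regIncBeta_half_eq hpq hq hqp hz,
    show 1 - 4 * p * q = (p - q) ^ 2 by linear_combination -(p + q + 1) * hpq] at h
  linarith

end NegativeBinomial

section ClosedForms

variable {p q lam τ₀ : ℝ} {z A : ℕ}

-- The odds `lam ^ d` turn the weight `p ^ z * q ^ k` of the negative binomial law into
-- `q ^ z * p ^ k`, so that only the laws with the parameters `p` and `q` are left.
lemma confirmMean_eq (hlam : lam * p = q) {χ : ℕ → ℝ} {c₁ c₂ c₃ c₄ : ℝ}
    (hχ : ∀ k d : ℕ, k + d = z → χ (1 + k) = c₁ + c₂ * lam ^ d + k * (c₃ + c₄ * lam ^ d)) :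
    confirmMean p q z χ z 1 = c₁ * negBinSum z z p q + c₂ * negBinSum z z q p +
      c₃ * ∑ k ∈ Finset.range z, (k : ℝ) * (z.multichoose k * p ^ z * q ^ k) +
      c₄ * ∑ k ∈ Finset.range z, (k : ℝ) * (z.multichoose k * q ^ z * p ^ k) := by
  simp only [confirmMean, negBinSum, Nat.add_sub_cancel, Finset.mul_sum,
    ← Finset.sum_add_distrib]
  refine Finset.sum_congr rfl fun k hk => ?_
  obtain ⟨d, rfl⟩ := Nat.exists_eq_add_of_le (Finset.mem_range.mp hk).le
  have hswap : p ^ (k + d) * q ^ k * lam ^ d = q ^ (k + d) * p ^ k := by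
    rw [← hlam]
    ring
  rw [hχ k d rfl]
  linear_combination ((k + d).multichoose k : ℝ) * (c₂ + k * c₄) * hswap

lemma pow_mul_pow_div_beta (p q : ℝ) (hz : z ≠ 0) :
    p ^ (z - 1) * q ^ z / beta (z : ℝ) z = z * z.multichoose z * p ^ (z - 1) * q ^ z := by
  rw [div_eq_mul_one_div, one_div_beta_natCast hz hz]
  ring

lemma sum_mul_negBin_eq (hpq : p + q = 1) (hp : 0 < p) (hq : 0 < q) (hz : z ≠ 0) :
    ∑ k ∈ Finset.range z, (k : ℝ) * (z.multichoose k * p ^ z * q ^ k) =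
      z * q / p * (1 - negBinSum z z q p) - p ^ (z - 1) * q ^ z / beta (z : ℝ) z := by
  rw [pow_mul_pow_div_beta p q hz, ← negBinSum_add_negBinSum hpq hp.le hq.le hz hz,
    add_sub_cancel_right]
  apply mul_left_cancel₀ hp.ne'
  rw [mul_sum_mul_negBin hpq, ← pow_sub_one_mul hz p]
  field_simp

lemma sum_mul_negBin_swap_eq (hpq : p + q = 1) (hq : 0 < q) (hz : z ≠ 0) :
    ∑ k ∈ Finset.range z, (k : ℝ) * (z.multichoose k * q ^ z * p ^ k) =
      z * p / q * negBinSum z z q p - p / q * (p ^ (z - 1) * q ^ z / beta (z : ℝ) z) := by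
  rw [pow_mul_pow_div_beta p q hz]
  apply mul_left_cancel₀ hq.ne'
  rw [mul_sum_mul_negBin (add_comm p q ▸ hpq), ← pow_sub_one_mul hz p]
  field_simp

lemma cycleValue_none (hpq : p + q = 1) (hp : 0 < p) (hq : 0 < q) (hlam : lam * p = q)
    (hz : z ≠ 0) {e α β c₁ c₂ c₃ c₄ : ℝ}
    (hχ : ∀ k d : ℕ, k + d = z →
      chaseValue p q lam e α β (A + 1) (1 + k) d - sureValue p q e α β z z (1 + k) =
        c₁ + c₂ * lam ^ d + k * (c₃ + c₄ * lam ^ d)) :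
    cycleValue p q lam e α β A z none =
      e / q + (α + β + z * ((e + q * β) / p)) +
        c₁ * (1 - negBinSum z z q p) + c₂ * negBinSum z z q p +
        c₃ * (z * q / p * (1 - negBinSum z z q p) - p ^ (z - 1) * q ^ z / beta (z : ℝ) z) +
        c₄ * (z * p / q * negBinSum z z q p -
          p / q * (p ^ (z - 1) * q ^ z / beta (z : ℝ) z)) := by
  have hmean := confirmMean_eq hlam (p := p) (q := q) (z := z)
    (χ := fun f => chaseValue p q lam e α β (A + 1) f (z + 1 - f) - sureValue p q e α β z z f)
    (c₁ := c₁) (c₂ := c₂) (c₃ := c₃) (c₄ := c₄) fun k d hd => by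
      rw [← hχ k d hd, show z + 1 - (1 + k) = d by omega]
  rw [← sum_mul_negBin_eq hpq hp hq hz, ← sum_mul_negBin_swap_eq hpq hq hz,
    ← eq_sub_of_add_eq (negBinSum_add_negBinSum hpq hp.le hq.le hz hz), cycleValue, waitValue,
    Nat.sub_zero, hmean, sureValue]
  push_cast
  ring

lemma cycleValue_success (hpq : p + q = 1) (hq : 0 < q) (hqp : q < p) (hlam : lam * p = q)
    (hz : z ≠ 0) :
    cycleValue p q lam 0 1 0 A z none =
      (2 * negBinSum z z q p - lam ^ (A + 1)) / (1 - lam ^ (A + 1)) := by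
  have hR : 1 - lam ^ (A + 1) ≠ 0 := sub_ne_zero.mpr (pow_succ_lt_one_of_mul_eq hq hqp hlam A).ne'
  rw [cycleValue_none hpq (hq.trans hqp) hq hlam hz (c₁ := -1 / (1 - lam ^ (A + 1)))
    (c₂ := 1 / (1 - lam ^ (A + 1))) (c₃ := 0) (c₄ := 0)]
  · field_simp
    ring
  · intro k d _
    rw [chaseValue, sureValue, ruinProb]
    field_simp
    ring

lemma eq_one_div_one_add (hpq : p + q = 1) (hlam : lam * p = q) : p = 1 / (1 + lam) :=
  eq_one_div_of_mul_eq_one_left (by linear_combination hpq + hlam)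

lemma sub_eq_one_sub_div_one_add (hpq : p + q = 1) (hlam : lam * p = q) :
    p - q = (1 - lam) / (1 + lam) := by
  rw [← hlam, eq_one_div_one_add hpq hlam]
  ring

lemma cycleValue_fork (hpq : p + q = 1) (hq : 0 < q) (hqp : q < p) (hlam : lam * p = q)
    (hz : z ≠ 0) :
    cycleValue p q lam 0 0 1 A z none =
      q * z / p * negBinSum z z q p
        - (A + 1) * lam ^ (A + 1) / (p * (1 - lam) ^ 3 * lamBracket lam (A + 1) ^ 2)
          * (1 - 2 * negBinSum z z q p)
        + (2 - lam + lam ^ (A + 2)) / ((1 - lam) ^ 2 * lamBracket lam (A + 1))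
          * (p ^ (z - 1) * q ^ z / beta z z)
        + (2 * negBinSum z z q p - lam ^ (A + 1)) / (1 - lam ^ (A + 1)) := by
  have hp : 0 < p := hq.trans hqp
  have hd : p - q ≠ 0 := (sub_pos.mpr hqp).ne'
  have hR : 1 - lam ^ (A + 1) ≠ 0 := sub_ne_zero.mpr (pow_succ_lt_one_of_mul_eq hq hqp hlam A).ne'
  rw [cycleValue_none hpq hp hq hlam hz
    (c₁ := -1 / (1 - lam ^ (A + 1)) + (q * lam ^ (A + 1) * z -
      (A + 1) * lam ^ (A + 1) / (1 - lam ^ (A + 1))) / ((p - q) * (1 - lam ^ (A + 1))))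
    (c₂ := 1 / (1 - lam ^ (A + 1)) + (p * z +
      (A + 1) * lam ^ (A + 1) / (1 - lam ^ (A + 1))) / ((p - q) * (1 - lam ^ (A + 1))))
    (c₃ := -1 / (1 - lam ^ (A + 1)) - q * lam ^ (A + 1) / ((p - q) * (1 - lam ^ (A + 1))))
    (c₄ := 1 / (1 - lam ^ (A + 1)) - p / ((p - q) * (1 - lam ^ (A + 1)))) fun k d hk => ?_]
  · have hlam1 : 1 - lam ≠ 0 := sub_ne_zero.mpr (lt_one_of_mul_eq hq hqp hlam).ne'
    have hlam0 : 0 < lam := pos_of_mul_pos_left (hlam ▸ hq) hp.le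
    rw [lamBracket, pow_succ lam (A + 1), sub_eq_one_sub_div_one_add hpq hlam, ← hlam]
    generalize negBinSum z z (lam * p) p = T
    generalize p ^ (z - 1) * (lam * p) ^ z / beta (z : ℝ) z = κ
    generalize lam ^ (A + 1) = Λ at *
    rw [eq_one_div_one_add hpq hlam]
    field_simp
    ring
  · rw [chaseValue, sureValue, ruinProb, ruinGain, ← hk]
    push_cast
    field_simp
    ring

lemma cycleValue_duration (hpq : p + q = 1) (hq : 0 < q) (hqp : q < p) (hlam : lam * p = q)
    (hz : z ≠ 0) (e : ℝ) :
    cycleValue p q lam e 0 0 A z none = e * (z / p * negBinSum z z q p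
        + (A + 1) / (p * (1 - lam) ^ 2 * lamBracket lam (A + 1)) * (1 - 2 * negBinSum z z q p)
        - p ^ (z - 1) * q ^ z / (p * (1 - lam) * beta z z) + 1 / q) := by
  have hp : 0 < p := hq.trans hqp
  have hd : p - q ≠ 0 := (sub_pos.mpr hqp).ne'
  have hR : 1 - lam ^ (A + 1) ≠ 0 := sub_ne_zero.mpr (pow_succ_lt_one_of_mul_eq hq hqp hlam A).ne'
  rw [cycleValue_none hpq hp hq hlam hz
    (c₁ := e * ((A + 1) / (1 - lam ^ (A + 1)) - z) / (p - q))
    (c₂ := -e * (A + 1) / (1 - lam ^ (A + 1)) / (p - q)) (c₃ := e / (p - q)) (c₄ := 0)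
    fun k d hk => ?_]
  · have hlam1 : 1 - lam ≠ 0 := sub_ne_zero.mpr (lt_one_of_mul_eq hq hqp hlam).ne'
    have hlam0 : 0 < lam := pos_of_mul_pos_left (hlam ▸ hq) hp.le
    rw [lamBracket, ← div_div _ _ (beta (z : ℝ) z), div_right_comm _ (p * (1 - lam)),
      sub_eq_one_sub_div_one_add hpq hlam, ← hlam]
    generalize negBinSum z z (lam * p) p = T
    generalize p ^ (z - 1) * (lam * p) ^ z / beta (z : ℝ) z = κ
    generalize lam ^ (A + 1) = Λ at *
    rw [eq_one_div_one_add hpq hlam]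
    field_simp
    ring
  · rw [chaseValue, sureValue, ruinTime, ← hk]
    push_cast
    field_simp
    ring

end ClosedForms

section Expectations

variable {Ω : Type*} {X Y : ℕ → Ω → ℝ}
variable {p q lam τ₀ : ℝ} {z A : ℕ}

open Classical in
lemma revenue_eq (A z : ℕ) (v b : ℝ) (X Y : ℕ → Ω → ℝ) (ω : Ω) :
    revenue A z v b X Y ω = v * (if IsSuccess A z X Y ω then (1 : ℝ) else 0) +
      b * if IsSuccess A z X Y ω then (secretFork Y (cycleDuration A z X Y ω) ω : ℝ) else 0 := by
  by_cases hs : IsSuccess A z X Y ω <;> simp [revenue, hs]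

variable [MeasurableSpace Ω] {μ : Measure Ω}

open Classical in
lemma integral_isSuccess (hpq : p + q = 1) (hq : 0 < q) (hqp : q < p) (hlam : lam * p = q)
    (hτ₀ : 0 < τ₀) (hz : z ≠ 0) (hA : z ≤ A) (hrace : IsMiningRace μ p q τ₀ X Y) :
    Integrable (fun ω => if IsSuccess A z X Y ω then (1 : ℝ) else 0) μ ∧
      ∫ ω, (if IsSuccess A z X Y ω then (1 : ℝ) else 0) ∂μ =
        (2 * negBinSum z z q p - lam ^ (A + 1)) / (1 - lam ^ (A + 1)) := by
  rw [← cycleValue_success hpq hq hqp hlam hz]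
  simpa using integral_cycle hpq hq hqp hlam hτ₀ hA hrace 0 1 0

open Classical in
lemma integral_secretFork (hpq : p + q = 1) (hq : 0 < q) (hqp : q < p) (hlam : lam * p = q)
    (hτ₀ : 0 < τ₀) (hA : z ≤ A) (hrace : IsMiningRace μ p q τ₀ X Y) :
    Integrable (fun ω => if IsSuccess A z X Y ω then
        (secretFork Y (cycleDuration A z X Y ω) ω : ℝ) else 0) μ ∧
      ∫ ω, (if IsSuccess A z X Y ω then
        (secretFork Y (cycleDuration A z X Y ω) ω : ℝ) else 0) ∂μ =
        cycleValue p q lam 0 0 1 A z none := by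
  simpa using integral_cycle hpq hq hqp hlam hτ₀ hA hrace 0 0 1

lemma integral_cycleDuration (hpq : p + q = 1) (hq : 0 < q) (hqp : q < p) (hlam : lam * p = q)
    (hτ₀ : 0 < τ₀) (hA : z ≤ A) (hrace : IsMiningRace μ p q τ₀ X Y) :
    Integrable (cycleDuration A z X Y) μ ∧
      ∫ ω, cycleDuration A z X Y ω ∂μ = cycleValue p q lam τ₀ 0 0 A z none := by
  simpa using integral_cycle hpq hq hqp hlam hτ₀ hA hrace 1 0 0

open Classical in
lemma successProb_eq_integral
    (hint : Integrable (fun ω => if IsSuccess A z X Y ω then (1 : ℝ) else 0) μ) :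
    successProb μ A z X Y = ∫ ω, (if IsSuccess A z X Y ω then (1 : ℝ) else 0) ∂μ := by
  have hmeas : NullMeasurableSet {ω | IsSuccess A z X Y ω} μ := by
    convert hint.aemeasurable.nullMeasurableSet_preimage (measurableSet_singleton (1 : ℝ)) using 1
    ext ω
    by_cases hs : IsSuccess A z X Y ω <;> simp [hs]
  rw [successProb, ← mul_one (μ.real _), ← smul_eq_mul, ← setIntegral_const,
    ← integral_indicator₀ hmeas]
  exact integral_congr_ae (.of_forall fun ω => by rw [Set.indicator_apply]; rfl)

lemma successProb_eq (hpq : p + q = 1) (hq : 0 < q) (hqp : q < p)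
    (hlam : lam * p = q) (hτ₀ : 0 < τ₀) (hz : z ≠ 0) (hA : z ≤ A)
    (hrace : IsMiningRace μ p q τ₀ X Y) :
    successProb μ A z X Y =
      (regIncBeta (4 * p * q) z (1 / 2) - lam ^ (A + 1)) / (1 - lam ^ (A + 1)) := by
  obtain ⟨hint, heq⟩ := integral_isSuccess hpq hq hqp hlam hτ₀ hz hA hrace
  rw [successProb_eq_integral hint, heq, regIncBeta_half_eq hpq hq hqp hz]

lemma integral_revenue (hpq : p + q = 1) (hq : 0 < q) (hqp : q < p)
    (hlam : lam * p = q) (hτ₀ : 0 < τ₀) (hz : z ≠ 0) (hA : z ≤ A)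
    (hrace : IsMiningRace μ p q τ₀ X Y) (v b : ℝ) :
    Integrable (revenue A z v b X Y) μ ∧
      ∫ ω, revenue A z v b X Y ω ∂μ =
        v * successProb μ A z X Y + b * cycleValue p q lam 0 0 1 A z none := by
  obtain ⟨hsuccess, -⟩ := integral_isSuccess hpq hq hqp hlam hτ₀ hz hA hrace
  obtain ⟨hfork, hfork_eq⟩ := integral_secretFork hpq hq hqp hlam hτ₀ hA hrace
  rw [successProb_eq_integral hsuccess, ← hfork_eq, ← integral_const_mul, ← integral_const_mul,
    ← integral_add (hsuccess.const_mul v) (hfork.const_mul b),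
    funext (revenue_eq A z v b X Y)]
  exact ⟨(hsuccess.const_mul v).add (hfork.const_mul b), rfl⟩

lemma integral_revenue_div (hpq : p + q = 1) (hq : 0 < q) (hqp : q < p)
    (hlam : lam * p = q) (hτ₀ : 0 < τ₀) (hz : z ≠ 0) (hA : z ≤ A)
    (hrace : IsMiningRace μ p q τ₀ X Y) (v : ℝ) {b : ℝ} (hb : b ≠ 0) :
    (∫ ω, revenue A z v b X Y ω ∂μ) / b =
      q * z / (2 * p) * regIncBeta (4 * p * q) z (1 / 2)
        - (A + 1) * lam ^ (A + 1) / (p * (1 - lam) ^ 3 * lamBracket lam (A + 1) ^ 2)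
          * regIncBeta ((p - q) ^ 2) (1 / 2) z
        + (2 - lam + lam ^ (A + 2)) / ((1 - lam) ^ 2 * lamBracket lam (A + 1))
          * (p ^ (z - 1) * q ^ z / beta z z)
        + successProb μ A z X Y * (v / b + 1) := by
  rw [(integral_revenue hpq hq hqp hlam hτ₀ hz hA hrace v b).2, cycleValue_fork hpq hq hqp hlam hz,
    ← regIncBeta_half_left_eq hpq hq hqp hz, ← regIncBeta_half_eq hpq hq hqp hz,
    ← successProb_eq hpq hq hqp hlam hτ₀ hz hA hrace, add_div, mul_div_cancel_left₀ _ hb,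
    show negBinSum z z q p = regIncBeta (4 * p * q) z (1 / 2) / 2 by
      rw [regIncBeta_half_eq hpq hq hqp hz, mul_div_cancel_left₀ _ two_ne_zero]]
  ring

lemma integral_cycleDuration_div (hpq : p + q = 1) (hq : 0 < q) (hqp : q < p)
    (hlam : lam * p = q) (hτ₀ : 0 < τ₀) (hz : z ≠ 0) (hA : z ≤ A)
    (hrace : IsMiningRace μ p q τ₀ X Y) :
    (∫ ω, cycleDuration A z X Y ω ∂μ) / τ₀ =
      z / (2 * p) * regIncBeta (4 * p * q) z (1 / 2)
        + (A + 1) / (p * (1 - lam) ^ 2 * lamBracket lam (A + 1))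
          * regIncBeta ((p - q) ^ 2) (1 / 2) z
        - p ^ (z - 1) * q ^ z / (p * (1 - lam) * beta z z)
        + 1 / q := by
  rw [(integral_cycleDuration hpq hq hqp hlam hτ₀ hA hrace).2,
    cycleValue_duration hpq hq hqp hlam hz, mul_div_cancel_left₀ _ hτ₀.ne',
    regIncBeta_half_left_eq hpq hq hqp hz, regIncBeta_half_eq hpq hq hqp hz]
  ring

lemma ae_cycleDuration_pos (hpq : p + q = 1) (hq : 0 < q) (hqp : q < p) (hτ₀ : 0 < τ₀)
    (hrace : IsMiningRace μ p q τ₀ X Y) (A z : ℕ) : ∀ᵐ ω ∂μ, 0 < cycleDuration A z X Y ω := by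
  have hlaunch : ∀ᵐ ω ∂μ, 0 < Y 0 ω := by
    have hlaw := hrace.attacker_law 0
    exact ae_of_ae_map hlaw.aemeasurable (hlaw.map_eq ▸ ae_expMeasure_pos _)
  filter_upwards [hlaunch, ae_nonempty_endingTimes hpq hq hqp hτ₀ hrace A z] with ω hpos hne
  exact (launchTime_eq (Y := Y) ω ▸ hpos).trans_le (le_csInf hne fun t ht => ht.1)

lemma integral_cycleDuration_pos (hpq : p + q = 1) (hq : 0 < q) (hqp : q < p)
    (hlam : lam * p = q) (hτ₀ : 0 < τ₀) (hA : z ≤ A) (hrace : IsMiningRace μ p q τ₀ X Y) :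
    0 < ∫ ω, cycleDuration A z X Y ω ∂μ := by
  have := hrace.indep.isProbabilityMeasure
  have hpos := ae_cycleDuration_pos hpq hq hqp hτ₀ hrace A z
  have hsupport : Function.support (cycleDuration A z X Y) =ᵐ[μ] Set.univ :=
    Filter.eventuallyEq_univ.mpr (hpos.mono fun _ hω => hω.ne')
  rw [integral_pos_iff_support_of_nonneg_ae (hpos.mono fun _ hω => hω.le)
      (integral_cycleDuration hpq hq hqp hlam hτ₀ hA hrace).1,
    measure_congr hsupport, measure_univ]
  exact one_pos

lemma revenueRatio_eq (v : ℝ) {b : ℝ} (hb : b ≠ 0) (hτ₀ : τ₀ ≠ 0) :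
    revenueRatio μ A z v b X Y =
      b / τ₀ * ((∫ ω, revenue A z v b X Y ω ∂μ) / b /
        ((∫ ω, cycleDuration A z X Y ω ∂μ) / τ₀)) := by
  rw [revenueRatio]
  field_simp

end Expectations

end Nakamoto

theorem theorem2 {Ω : Type*} [MeasurableSpace Ω] (μ : Measure Ω) [IsProbabilityMeasure μ]
    (p q lam τ₀ b v : ℝ) (hq0 : 0 < q) (hq : q < 1 / 2) (hp : p = 1 - q) (hlam : lam = q / p)
    (hτ₀ : 0 < τ₀) (hb : 0 < b) (z A : ℕ) (hz : 1 ≤ z) (hA : z ≤ A)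
    (X Y : ℕ → Ω → ℝ) (hrace : Nakamoto.IsMiningRace μ p q τ₀ X Y) :
    -- the attack cycle ends almost surely, and its revenue and its duration are integrable
    (∀ᵐ ω ∂μ, (Nakamoto.endingTimes A z X Y ω).Nonempty) ∧
    Integrable (Nakamoto.revenue A z v b X Y) μ ∧
    Integrable (Nakamoto.cycleDuration A z X Y) μ ∧
    -- the probability of success
    Nakamoto.successProb μ A z X Y =
      (regIncBeta (4 * p * q) z (1 / 2) - lam ^ (A + 1)) / (1 - lam ^ (A + 1)) ∧
    -- the expected revenue
    (∫ ω, Nakamoto.revenue A z v b X Y ω ∂μ) / b =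
      q * z / (2 * p) * regIncBeta (4 * p * q) z (1 / 2)
        - (A + 1) * lam ^ (A + 1) / (p * (1 - lam) ^ 3 * lamBracket lam (A + 1) ^ 2)
          * regIncBeta ((p - q) ^ 2) (1 / 2) z
        + (2 - lam + lam ^ (A + 2)) / ((1 - lam) ^ 2 * lamBracket lam (A + 1))
          * (p ^ (z - 1) * q ^ z / beta z z)
        + Nakamoto.successProb μ A z X Y * (v / b + 1) ∧
    -- the expected duration
    (∫ ω, Nakamoto.cycleDuration A z X Y ω ∂μ) / τ₀ =
      z / (2 * p) * regIncBeta (4 * p * q) z (1 / 2)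
        + (A + 1) / (p * (1 - lam) ^ 2 * lamBracket lam (A + 1))
          * regIncBeta ((p - q) ^ 2) (1 / 2) z
        - p ^ (z - 1) * q ^ z / (p * (1 - lam) * beta z z)
        + 1 / q ∧
    -- the revenue ratio
    0 < ∫ ω, Nakamoto.cycleDuration A z X Y ω ∂μ ∧
    Nakamoto.revenueRatio μ A z v b X Y =
      b / τ₀ *
        ((q * z / (2 * p) * regIncBeta (4 * p * q) z (1 / 2)
            - (A + 1) * lam ^ (A + 1) / (p * (1 - lam) ^ 3 * lamBracket lam (A + 1) ^ 2)
              * regIncBeta ((p - q) ^ 2) (1 / 2) z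
            + (2 - lam + lam ^ (A + 2)) / ((1 - lam) ^ 2 * lamBracket lam (A + 1))
              * (p ^ (z - 1) * q ^ z / beta z z)
            + Nakamoto.successProb μ A z X Y * (v / b + 1)) /
          (z / (2 * p) * regIncBeta (4 * p * q) z (1 / 2)
            + (A + 1) / (p * (1 - lam) ^ 2 * lamBracket lam (A + 1))
              * regIncBeta ((p - q) ^ 2) (1 / 2) z
            - p ^ (z - 1) * q ^ z / (p * (1 - lam) * beta z z)
            + 1 / q)) := by
  have hpq : p + q = 1 := by rw [hp, sub_add_cancel]
  have hqp : q < p := by linarith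
  have hlam_mul : lam * p = q := by rw [hlam, div_mul_cancel₀ q (hq0.trans hqp).ne']
  have hz_ne : z ≠ 0 := Nat.one_le_iff_ne_zero.mp hz
  have hrevenue :=
    Nakamoto.integral_revenue_div hpq hq0 hqp hlam_mul hτ₀ hz_ne hA hrace v hb.ne'
  have hduration := Nakamoto.integral_cycleDuration_div hpq hq0 hqp hlam_mul hτ₀ hz_ne hA hrace
  refine ⟨Nakamoto.ae_nonempty_endingTimes hpq hq0 hqp hτ₀ hrace A z,
    (Nakamoto.integral_revenue hpq hq0 hqp hlam_mul hτ₀ hz_ne hA hrace v b).1,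
    (Nakamoto.integral_cycleDuration hpq hq0 hqp hlam_mul hτ₀ hA hrace).1,
    Nakamoto.successProb_eq hpq hq0 hqp hlam_mul hτ₀ hz_ne hA hrace, hrevenue, hduration,
    Nakamoto.integral_cycleDuration_pos hpq hq0 hqp hlam_mul hτ₀ hA hrace, ?_⟩
  rw [← hrevenue, ← hduration]
  exact Nakamoto.revenueRatio_eq v hb.ne' hτ₀.ne'
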